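/- Theorem ($H^k$ estimates). Let $n\ge 2$, $k\ge 2$, $0<\lambda\le\Lambda$, $L>0$, $\overline L>0$, and write $B_\rho=\{x\in\mathbb R^n:|x|<\rho\}$. There are constants $C=C(R,r)>0$ for $0<r<R$, depending only on $n,k,\lambda,\Lambda,L,\overline L$ and on $R,r$ (and allowed to degenerate: $C(R,r)\to+\infty$ as $R-r\to0$), such that the following holds for every $R>0$. Let $A=(a_{ij})_{i,j=1}^n:B_R\to\mathbb R^{n\times n}$ (not necessarily symmetric) satisfy $$\lambda|\xi|^2\le A(x)\xi\cdot\xi\le\Lambda|\xi|^2\quad\text{for all }x\in B_R,\ \xi\in\mathbb R^n,\qquad \max_{i,j}\|a_{ij}\|_{L^\infty(B_R)}\le L,$$ let $a_{ij}\in C^{k-2,1}(B_R)$ with $\max_{i,j}\|a_{ij}\|_{C^{k-2,1}(B_R)}\le\overline L$, where $C^{m,1}(B_R)$ is the space of functions of class $C^m$ in $B_R$ whose partial derivatives up to order $m$ are uniformly continuous in $B_R$ and whose derivatives of order $m$ are Lipschitz, with $$\|f\|_{C^{m,1}(B_R)}=\sum_{|\beta|\le m}\|D^\beta f\|_{L^\infty(B_R)}+\sum_{|\beta|=m}\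 \sup_{x\ne y\in B_R}\frac{|D^\beta f(x)-D^\beta f(y)|}{|x-y|},$$ let $F=(F_1,\dots,F_n)$ with $F_i\in H^{k-1}(B_R)$, and let $u\in H^1(B_R)$ be a weak solution of $-\mathrm{div}(A\nabla u)=\mathrm{div}F$ in $B_R$, that is $$\int_{B_R}A\nabla u\cdot\nabla\phi=-\int_{B_R}F\cdot\nabla\phi\qquad\text{for all }\phi\in C_c^\infty(B_R).$$ Then $u\in H^k_{\mathrm{loc}}(B_R)$ (that is, $u\in H^k(V)$ for every open $V$ with compact closure contained in $B_R$), and for every $0<r<R$ one has $u\in H^k(B_r)$ and $$\|u\|_{H^k(B_r)}\le C(R,r)\left(\|u\|_{L^2(B_R)}+\|F\|_{H^{k-1}(B_R)}\right).$$ Here $H^k=W^{k,2}$, with $\|u\|_{H^k(\Omega)}^2=\sum_{|\beta|\le k}\|D^\beta u\|_{L^2(\Omega)}^2$ for weak derivatives $D^\beta u$, and $\|F\|_{H^{k-1}}^2=\sum_i\|F_i\|_{H^{k-1}}^2$. -/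

import Mathlib

open MeasureTheory Metric
open scoped ENNReal ContDiff Matrix

noncomputable section

/-- `ℝⁿ` with the Euclidean norm. -/
abbrev EucSp (n : ℕ) : Type := EuclideanSpace ℝ (Fin n)

/-- The classical partial derivative `∂ᵢ f`. -/
def partialD {n : ℕ} (i : Fin n) (f : EucSp n → ℝ) : EucSp n → ℝ :=
  fun x => fderiv ℝ f x (EuclideanSpace.single i 1)

/-- The classical iterated partial derivative `D^β f = ∂₁^{β₁} ⋯ ∂ₙ^{βₙ} f` of a multi-index `β`. -/
def multiD {n : ℕ} (β : Fin n → ℕ) (f : EucSp n → ℝ) : EucSp n → ℝ :=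
  (List.finRange n).foldr (fun i g => (partialD i)^[β i] g) f

/-- The finite set of multi-indices `β ∈ ℕⁿ` with `|β| = β₁ + ⋯ + βₙ = j`. -/
def multiIdx (n j : ℕ) : Finset (Fin n → ℕ) := Finset.piAntidiag Finset.univ j

theorem mem_multiIdx {n j : ℕ} {β : Fin n → ℕ} : β ∈ multiIdx n j ↔ ∑ i, β i = j := by
  simp [multiIdx]

/-- `φ ∈ C_c^∞(Ω)`. -/
def IsTestFn {n : ℕ} (Ω : Set (EucSp n)) (φ : EucSp n → ℝ) : Prop :=
  ContDiff ℝ ∞ φ ∧ HasCompactSupport φ ∧ tsupport φ ⊆ Ω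

/-- `v` is the weak derivative `D^β u` in the open set `Ω`. -/
def HasWeakD {n : ℕ} (Ω : Set (EucSp n)) (β : Fin n → ℕ) (u v : EucSp n → ℝ) : Prop :=
  LocallyIntegrableOn u Ω ∧ LocallyIntegrableOn v Ω ∧
    ∀ φ : EucSp n → ℝ, IsTestFn Ω φ →
      ∫ x in Ω, u x * multiD β φ x = (-1) ^ (∑ i, β i) * ∫ x in Ω, v x * φ x

open Classical in
/-- The weak derivative `D^β u` in `Ω`, a function determined almost everywhere in `Ω`
(and `0` if there is none). -/
def weakD {n : ℕ} (Ω : Set (EucSp n)) (β : Fin n → ℕ) (u : EucSp n → ℝ) : EucSp n → ℝ :=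
  if h : ∃ v, HasWeakD Ω β u v then h.choose else 0

theorem HasWeakD.weakD {n : ℕ} {Ω : Set (EucSp n)} {β : Fin n → ℕ} {u v : EucSp n → ℝ}
    (h : HasWeakD Ω β u v) : HasWeakD Ω β u (weakD Ω β u) := by
  have h' : ∃ v, HasWeakD Ω β u v := ⟨v, h⟩
  rw [_root_.weakD, dif_pos h']
  exact h'.choose_spec

/-- Weak derivatives are unique almost everywhere. -/
theorem HasWeakD.ae_eq {n : ℕ} {Ω : Set (EucSp n)} (hΩ : IsOpen Ω) {β : Fin n → ℕ}
    {u v w : EucSp n → ℝ} (hv : HasWeakD Ω β u v) (hw : HasWeakD Ω β u w) :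
    v =ᵐ[volume.restrict Ω] w := by
  rw [Filter.EventuallyEq, ae_restrict_iff' hΩ.measurableSet]
  have h0 : ∀ᵐ x ∂volume, x ∈ Ω → (v - w) x = 0 := by
    refine IsOpen.ae_eq_zero_of_integral_contDiff_smul_eq_zero hΩ (hv.2.1.sub hw.2.1) ?_
    intro g hg hc hs
    have hint : ∀ z, HasWeakD Ω β u z → Integrable (fun x => g x • z x) := by
      intro z hz
      have hz' : IntegrableOn z (tsupport g) := hz.2.1.integrableOn_compact_subset hs hc
      have := hz'.continuousOn_smul hg.continuous.continuousOn hc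
      exact (integrableOn_iff_integrable_of_support_subset fun x hx =>
        subset_tsupport g (fun h => hx (by simp [h]))).1 this
    have key : ∀ z, HasWeakD Ω β u z →
        ∫ x, g x • z x = (-1) ^ (∑ i, β i) * ∫ x in Ω, u x * multiD β g x := by
      intro z hz
      rw [hz.2.2 g ⟨hg, hc, hs⟩, ← mul_assoc, ← mul_pow]
      have h0 : ∀ x, x ∉ Ω → z x * g x = 0 := fun x hx => by
        rw [image_eq_zero_of_notMem_tsupport (fun h => hx (hs h)), mul_zero]
      rw [setIntegral_eq_integral_of_forall_compl_eq_zero h0]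
      simp [mul_comm]
    simp only [Pi.sub_apply, smul_sub]
    rw [integral_sub (hint v hv) (hint w hw), key v hv, key w hw, sub_self]
  filter_upwards [h0] with x hx hxΩ
  exact sub_eq_zero.1 (hx hxΩ)

/-- `u ∈ H^k(Ω) = W^{k,2}(Ω)`: `u` and its weak derivatives up to order `k` are in `L²(Ω)`. -/
def MemHk {n : ℕ} (k : ℕ) (Ω : Set (EucSp n)) (u : EucSp n → ℝ) : Prop :=
  MemLp u 2 (volume.restrict Ω) ∧
    ∀ β : Fin n → ℕ, ∑ i, β i ≤ k →
      ∃ v, HasWeakD Ω β u v ∧ MemLp v 2 (volume.restrict Ω)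

/-- `u ∈ H^k_loc(Ω)`: `u ∈ H^k(V)` for every open `V ⊂⊂ Ω`. -/
def MemHkLoc {n : ℕ} (k : ℕ) (Ω : Set (EucSp n)) (u : EucSp n → ℝ) : Prop :=
  ∀ V : Set (EucSp n), IsOpen V → IsCompact (closure V) → closure V ⊆ Ω → MemHk k V u

/-- The squared norm `‖u‖²_{H^k(Ω)} = ∑_{|β| ≤ k} ‖D^β u‖²_{L²(Ω)}`, for `u ∈ H^k(Ω)`. -/
def sqNormHk {n : ℕ} (k : ℕ) (Ω : Set (EucSp n)) (u : EucSp n → ℝ) : ℝ≥0∞ :=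
  ∑ j ∈ Finset.range (k + 1), ∑ β ∈ multiIdx n j,
    eLpNorm (weakD Ω β u) 2 (volume.restrict Ω) ^ 2

/-- The norm `‖u‖_{H^k(Ω)}` of a function `u ∈ H^k(Ω)`. -/
def normHk {n : ℕ} (k : ℕ) (Ω : Set (EucSp n)) (u : EucSp n → ℝ) : ℝ≥0∞ :=
  sqNormHk k Ω u ^ (1 / 2 : ℝ)

/-- The norm `‖F‖_{H^k(Ω)} = (∑ᵢ ‖Fᵢ‖²_{H^k(Ω)})^{1/2}` of a field `F` with all `Fᵢ ∈ H^k(Ω)`. -/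
def normHkField {n : ℕ} (k : ℕ) (Ω : Set (EucSp n)) (F : EucSp n → Fin n → ℝ) : ℝ≥0∞ :=
  (∑ i, sqNormHk k Ω (fun x => F x i)) ^ (1 / 2 : ℝ)

/-- The Lipschitz seminorm `[f]_{C^{0,1}(Ω)}`. -/
def lipSeminorm {n : ℕ} (Ω : Set (EucSp n)) (f : EucSp n → ℝ) : ℝ≥0∞ :=
  ⨆ x ∈ Ω, ⨆ y ∈ Ω, ⨆ _ : x ≠ y, ‖f x - f y‖ₑ / edist x y

/-- `f ∈ C^{m,1}(Ω)`, `Ω` open and bounded: `f` is of class `C^m` in `Ω`, its partial derivatives up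
to order `m` are uniformly continuous in `Ω`, and those of order `m` are Lipschitz in `Ω`. -/
def MemCkLip {n : ℕ} (m : ℕ) (Ω : Set (EucSp n)) (f : EucSp n → ℝ) : Prop :=
  ContDiffOn ℝ m f Ω ∧
    (∀ β : Fin n → ℕ, ∑ i, β i ≤ m → UniformContinuousOn (multiD β f) Ω) ∧
    ∀ β : Fin n → ℕ, ∑ i, β i = m → lipSeminorm Ω (multiD β f) < ⊤

/-- The norm
`‖f‖_{C^{m,1}(Ω)} = ∑_{|β| ≤ m} ‖D^β f‖_{L^∞(Ω)} + ∑_{|β| = m} [D^β f]_{C^{0,1}(Ω)}`. -/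
def normCkLip {n : ℕ} (m : ℕ) (Ω : Set (EucSp n)) (f : EucSp n → ℝ) : ℝ≥0∞ :=
  (∑ j ∈ Finset.range (m + 1), ∑ β ∈ multiIdx n j,
      eLpNorm (multiD β f) ⊤ (volume.restrict Ω)) +
    ∑ β ∈ multiIdx n m, lipSeminorm Ω (multiD β f)

/-- Uniform ellipticity of `A` in `Ω`: `λ|ξ|² ≤ A(x)ξ·ξ ≤ Λ|ξ|²` for all `x ∈ Ω`, `ξ ∈ ℝⁿ`, and all
the entries of `A` are bounded by `L` in `L^∞(Ω)`. -/
def IsUnifElliptic {n : ℕ} (lam Lam L : ℝ) (Ω : Set (EucSp n))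
    (A : EucSp n → Matrix (Fin n) (Fin n) ℝ) : Prop :=
  (∀ x ∈ Ω, ∀ ξ : Fin n → ℝ,
      lam * (ξ ⬝ᵥ ξ) ≤ (A x *ᵥ ξ) ⬝ᵥ ξ ∧ (A x *ᵥ ξ) ⬝ᵥ ξ ≤ Lam * (ξ ⬝ᵥ ξ)) ∧
    ∀ i j, eLpNorm (fun x => A x i j) ⊤ (volume.restrict Ω) ≤ ENNReal.ofReal L

/-- The weak gradient `∇u` in `Ω`. -/
def weakGrad {n : ℕ} (Ω : Set (EucSp n)) (u : EucSp n → ℝ) (x : EucSp n) : Fin n → ℝ :=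
  fun i => weakD Ω (Pi.single i 1) u x

/-- The classical gradient `∇φ`. -/
def classGrad {n : ℕ} (φ : EucSp n → ℝ) (x : EucSp n) : Fin n → ℝ :=
  fun i => partialD i φ x

/-- `u` is a weak solution of `-div(A∇u) = div F` in `Ω`: `u ∈ H¹(Ω)` and
`∫_Ω A∇u·∇φ = -∫_Ω F·∇φ` for every `φ ∈ C_c^∞(Ω)`. -/
def IsWeakSol {n : ℕ} (Ω : Set (EucSp n)) (A : EucSp n → Matrix (Fin n) (Fin n) ℝ)
    (F : EucSp n → Fin n → ℝ) (u : EucSp n → ℝ) : Prop :=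
  MemHk 1 Ω u ∧
    ∀ φ : EucSp n → ℝ, IsTestFn Ω φ →
      ∫ x in Ω, (A x *ᵥ weakGrad Ω u x) ⬝ᵥ classGrad φ x = -∫ x in Ω, F x ⬝ᵥ classGrad φ x

end

/-!
# Interior `H^k` estimates for divergence-form elliptic equations

A weak solution of `-div(A∇u) = div F` satisfies `div(A∇u + F) = 0` weakly, and everything is
deduced from three facts about such solutions on concentric balls.

* Testing with `η²u`, where `η` is a cut-off function, bounds `∇u` in `L²` of a smaller ball by `u`
  and `F` (Caccioppoli's inequality, `exists_caccioppoli`).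
* If `A` is Lipschitz and `F ∈ H¹`, then `w = ηu` is a compactly supported solution of
  `-div(A∇w) = f` with `f ∈ L²`. Testing with the second difference `2w - w(· + y) - w(· - y)` and
  using ellipticity at the translated point bounds the difference `∇w(· + y) - ∇w` in `L²` by `C|y|`
  (`exists_nirenberg`). Bounded difference quotients have a weak limit point in `L²`, which is the
  weak derivative (`exists_isWeakPartial_of_translate_bound`); hence `∇u ∈ H¹` of a smaller ball
  (`exists_second_order`).
* Differentiating the equation, `∂ₗu` solves the same kind of equation with `∂ₗF + (∂ₗA)∇u` in place
  of `F`, and this field is in `H^m` as soon as `∇u`, `∂ₗF` are in `H^m` and `∂ₗA` is in `W^{m,∞}`.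
  Induction on the order, with a loss of radius at each step, gives `exists_higher_order`.

Test functions are replaced by compactly supported Sobolev functions in the weak formulation by
mollification (`integral_sum_eq_of_forall_isTestFn`); the product rule for a `W^{1,∞}` coefficient
and an `H¹` function is an instance of the same principle (`IsWeakPartial.bdd_mul`). A `C^{m,1}`
coefficient lies in `W^{m+1,∞}` by Rademacher's theorem (`MemCkLip.regular`). The quantitative
statements are phrased with the recursive predicates `HkBound` and `WkInfBound`, which are compared
with the multi-index definitions of `H^k` and `C^{m,1}` at the end.
-/

section Sobolev

open Filter Set
open scoped Topology NNReal

variable {n : ℕ}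

/-! ### Test functions and partial derivatives -/

/-- The coordinate vector `eᵢ` of `ℝⁿ`. -/
noncomputable abbrev coordVec (i : Fin n) : EucSp n := EuclideanSpace.single i 1

theorem norm_coordVec (i : Fin n) : ‖coordVec i‖ = 1 := by simp [coordVec]

theorem partialD_mul (i : Fin n) {f g : EucSp n → ℝ} {x : EucSp n}
    (hf : DifferentiableAt ℝ f x) (hg : DifferentiableAt ℝ g x) :
    partialD i (fun y => f y * g y) x = partialD i f x * g x + f x * partialD i g x := by
  unfold partialD
  rw [fderiv_fun_mul hf hg]
  simp
  ring

theorem contDiff_partialD (i : Fin n) {f : EucSp n → ℝ} (hf : ContDiff ℝ ∞ f) :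
    ContDiff ℝ ∞ (partialD i f) :=
  (hf.fderiv_right (m := ∞) (by simp)).clm_apply contDiff_const

theorem partialD_comm_of_contDiffOn {Ω : Set (EucSp n)} (hΩ : IsOpen Ω) {f : EucSp n → ℝ}
    (hf : ContDiffOn ℝ 2 f Ω) (i j : Fin n) :
    EqOn (partialD i (partialD j f)) (partialD j (partialD i f)) Ω := by
  intro x hx
  have hfx : ContDiffAt ℝ 2 f x := hf.contDiffAt (hΩ.mem_nhds hx)
  have h1 : ∀ a b : Fin n, partialD a (partialD b f) x
      = fderiv ℝ (fderiv ℝ f) x (coordVec a) (coordVec b) := by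
    intro a b
    have hd : DifferentiableAt ℝ (fderiv ℝ f) x :=
      (hfx.fderiv_right (m := 1) (by norm_num)).differentiableAt (by simp)
    unfold partialD
    rw [fderiv_clm_apply hd (differentiableAt_const _)]
    simp
  rw [h1, h1]
  exact hfx.isSymmSndFDerivAt (by simp) _ _

theorem partialD_comm (i j : Fin n) {f : EucSp n → ℝ} (hf : ContDiff ℝ ∞ f) :
    partialD i (partialD j f) = partialD j (partialD i f) := by
  ext x
  exact partialD_comm_of_contDiffOn isOpen_univ
    (hf.of_le (WithTop.coe_le_coe.2 le_top)).contDiffOn i j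
    (mem_univ x)

theorem tsupport_partialD_subset (i : Fin n) (f : EucSp n → ℝ) :
    tsupport (partialD i f) ⊆ tsupport f :=
  tsupport_fderiv_apply_subset ℝ _

namespace IsTestFn

variable {Ω Ω' : Set (EucSp n)} {φ η : EucSp n → ℝ}

theorem mono (h : IsTestFn Ω φ) (hΩ : Ω ⊆ Ω') : IsTestFn Ω' φ :=
  ⟨h.1, h.2.1, h.2.2.trans hΩ⟩

theorem partialD (h : IsTestFn Ω φ) (i : Fin n) : IsTestFn Ω (partialD i φ) :=
  ⟨contDiff_partialD i h.1, h.2.1.mono' ((subset_tsupport _).trans (tsupport_partialD_subset i φ)),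
    (tsupport_partialD_subset i φ).trans h.2.2⟩

theorem mul_left (h : IsTestFn Ω φ) (hη : ContDiff ℝ ∞ η) : IsTestFn Ω (fun x => η x * φ x) :=
  ⟨hη.mul h.1, h.2.1.mul_left, (tsupport_mul_subset_right).trans h.2.2⟩

theorem mul_right (h : IsTestFn Ω φ) (hη : ContDiff ℝ ∞ η) : IsTestFn Ω (fun x => φ x * η x) :=
  ⟨h.1.mul hη, h.2.1.mul_right, (tsupport_mul_subset_left).trans h.2.2⟩

theorem continuous (h : IsTestFn Ω φ) : Continuous φ := h.1.continuous

theorem differentiable (h : IsTestFn Ω φ) : Differentiable ℝ φ := h.1.differentiable (by simp)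

theorem eq_zero (h : IsTestFn Ω φ) {x : EucSp n} (hx : x ∉ Ω) : φ x = 0 :=
  image_eq_zero_of_notMem_tsupport fun h' => hx (h.2.2 h')

theorem exists_bound (h : IsTestFn Ω φ) : ∃ C : ℝ≥0, ∀ x, |φ x| ≤ C := by
  obtain ⟨C, hC⟩ := h.2.1.exists_bound_of_continuous h.continuous
  exact ⟨C.toNNReal, fun x => (hC x).trans (Real.le_coe_toNNReal C)⟩

theorem memLp (h : IsTestFn Ω φ) (p : ℝ≥0∞) (μ : Measure (EucSp n)) [IsFiniteMeasureOnCompacts μ] :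
    MemLp φ p μ :=
  h.continuous.memLp_of_hasCompactSupport h.2.1

theorem exists_closedBall {R : ℝ} (h : IsTestFn (ball 0 R) φ) :
    ∃ ρ < R, ∀ x ∉ closedBall (0 : EucSp n) ρ, φ x = 0 := by
  obtain ⟨ρ, hρ, hs⟩ := exists_lt_subset_ball (isClosed_tsupport φ) h.2.2
  exact ⟨ρ, hρ, fun x hx => image_eq_zero_of_notMem_tsupport fun h' =>
    hx (ball_subset_closedBall (hs h'))⟩

end IsTestFn

/-- Smooth cut-off functions between concentric balls. -/
theorem exists_cutoff {r R : ℝ} (hr : 0 < r) (hrR : r < R) :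
    ∃ η : EucSp n → ℝ, IsTestFn (ball 0 R) η ∧ (∀ x ∈ ball (0 : EucSp n) r, η x = 1) ∧
      ∀ x, η x ∈ Icc (0 : ℝ) 1 := by
  let b : ContDiffBump (0 : EucSp n) := ⟨r, (r + R) / 2, hr, by linarith⟩
  refine ⟨b, ⟨b.contDiff, b.hasCompactSupport, ?_⟩, fun x hx => ?_, fun x => ⟨b.nonneg, b.le_one⟩⟩
  · rw [b.tsupport_eq]
    exact closedBall_subset_ball (by show (r + R) / 2 < R; linarith)
  · exact b.one_of_mem_closedBall (ball_subset_closedBall hx)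

/-! ### `L²` bounds -/

section L2

variable {X : Type*} [MeasurableSpace X] {μ : Measure X}

theorem integrable_mul_of_memLp_two {f g : X → ℝ} (hf : MemLp f 2 μ) (hg : MemLp g 2 μ) :
    Integrable (fun x => f x * g x) μ :=
  hf.integrable_mul hg

theorem toReal_eLpNorm_two_sq {f : X → ℝ} (hf : MemLp f 2 μ) :
    (eLpNorm f 2 μ).toReal ^ 2 = ∫ x, f x ^ 2 ∂μ := by
  rw [hf.eLpNorm_eq_integral_rpow_norm (by simp) (by simp), ENNReal.toReal_ofReal (by positivity)]
  have h0 : 0 ≤ ∫ x, f x ^ 2 ∂μ := integral_nonneg fun x => sq_nonneg _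
  have : ∀ x, ‖f x‖ ^ (2 : ℝ≥0∞).toReal = f x ^ 2 := fun x => by simp
  simp_rw [this]
  rw [← Real.rpow_natCast, ← Real.rpow_mul h0]
  simp

/-- The Cauchy–Schwarz inequality. -/
theorem abs_integral_mul_le {f g : X → ℝ} (hf : MemLp f 2 μ) (hg : MemLp g 2 μ) :
    |∫ x, f x * g x ∂μ| ≤ (eLpNorm f 2 μ).toReal * (eLpNorm g 2 μ).toReal := by
  have h := norm_inner_le_norm (𝕜 := ℝ) hf.toLp hg.toLp
  rw [Lp.norm_toLp, Lp.norm_toLp, L2.inner_def] at h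
  refine le_trans (le_of_eq ?_) h
  rw [Real.norm_eq_abs]
  congr 1
  refine integral_congr_ae ?_
  filter_upwards [hf.coeFn_toLp, hg.coeFn_toLp] with x hx hy
  simp [hx, hy, mul_comm]

/-- The bound `K` may be infinite, in which case `K.toReal = 0` and the conclusion is trivial. -/
theorem eLpNorm_two_le_of_integral_sq_le {f : X → ℝ} (hf : MemLp f 2 μ) {K : ℝ≥0∞}
    (h : ∫ x, f x ^ 2 ∂μ ≤ K.toReal ^ 2) : eLpNorm f 2 μ ≤ K := by
  by_cases hK : K = ⊤
  · simp [hK]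
  rw [← toReal_eLpNorm_two_sq hf] at h
  exact (ENNReal.toReal_le_toReal hf.2.ne hK).1
    ((sq_le_sq₀ ENNReal.toReal_nonneg ENNReal.toReal_nonneg).1 h)

/-- Integration against a fixed `L²` function is continuous in `L²`. -/
theorem tendsto_integral_mul_of_tendsto_eLpNorm {f : X → ℝ} {u : ℕ → X → ℝ} {w : X → ℝ}
    (hf : MemLp f 2 μ) (hu : ∀ k, MemLp (u k) 2 μ) (hw : MemLp w 2 μ)
    (h : Tendsto (fun k => eLpNorm (fun x => u k x - w x) 2 μ) atTop (𝓝 0)) :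
    Tendsto (fun k => ∫ x, f x * u k x ∂μ) atTop (𝓝 (∫ x, f x * w x ∂μ)) := by
  rw [tendsto_iff_norm_sub_tendsto_zero]
  have h2 : Tendsto (fun k => (eLpNorm f 2 μ).toReal *
      (eLpNorm (fun x => u k x - w x) 2 μ).toReal) atTop (𝓝 0) := by
    have := ((ENNReal.tendsto_toReal ENNReal.zero_ne_top).comp h).const_mul (eLpNorm f 2 μ).toReal
    simpa using this
  refine squeeze_zero (fun _ => norm_nonneg _) (fun k => ?_) h2
  rw [← integral_sub (integrable_mul_of_memLp_two hf (hu k)) (integrable_mul_of_memLp_two hf hw)]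
  simp_rw [← mul_sub]
  exact abs_integral_mul_le hf ((hu k).sub hw)

theorem MeasureTheory.MemLp.bdd_mul_two {a f : X → ℝ} {M : ℝ≥0} (hf : MemLp f 2 μ)
    (ha : AEStronglyMeasurable a μ) (hM : ∀ᵐ x ∂μ, |a x| ≤ M) :
    MemLp (fun x => a x * f x) 2 μ :=
  hf.of_le_mul (c := M) (ha.mul hf.1) (by
    filter_upwards [hM] with x hx
    rw [norm_mul]
    exact mul_le_mul_of_nonneg_right hx (norm_nonneg _))

theorem eLpNorm_bdd_mul_le {a f : X → ℝ} {M : ℝ≥0} (hM : ∀ᵐ x ∂μ, |a x| ≤ M) (p : ℝ≥0∞) :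
    eLpNorm (fun x => a x * f x) p μ ≤ M * eLpNorm f p μ := by
  have := eLpNorm_le_nnreal_smul_eLpNorm_of_ae_le_mul (μ := μ) (f := fun x => a x * f x) (g := f)
    (c := M) (by
      filter_upwards [hM] with x hx
      rw [nnnorm_mul]
      exact mul_le_mul_of_nonneg_right (by exact_mod_cast hx) (zero_le)) p
  simpa [ENNReal.smul_def] using this

end L2

/-! ### Averages, translations and mollification in `L²` -/

theorem eLpNorm_two_sq {X : Type*} [MeasurableSpace X] (μ : Measure X) (f : X → ℝ) :
    eLpNorm f 2 μ ^ 2 = ∫⁻ x, ‖f x‖ₑ ^ 2 ∂μ := by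
  rw [eLpNorm_eq_lintegral_rpow_enorm_toReal (by simp) (by simp), ← ENNReal.rpow_natCast,
    ← ENNReal.rpow_mul]
  simp

/-- Minkowski's inequality for averages, in squared form: the squared `L²` norm of an average is at
most the average of the squared `L²` norms. -/
theorem lintegral_enorm_integral_sq_le {X Θ : Type*} [MeasurableSpace X] [MeasurableSpace Θ]
    {μ : Measure X} [SFinite μ] {P : Measure Θ} [IsProbabilityMeasure P] {q : X → Θ → ℝ}
    (hq : AEStronglyMeasurable (Function.uncurry q) (μ.prod P)) :
    ∫⁻ x, ‖∫ θ, q x θ ∂P‖ₑ ^ 2 ∂μ ≤ ∫⁻ θ, ∫⁻ x, ‖q x θ‖ₑ ^ 2 ∂μ ∂P := by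
  have hm : AEMeasurable (Function.uncurry fun x θ => ‖q x θ‖ₑ ^ 2) (μ.prod P) :=
    hq.enorm.pow_const 2
  rw [← lintegral_lintegral_swap hm]
  refine lintegral_mono_ae ?_
  filter_upwards [hq.prodMk_left] with x hx
  have h1 : ‖∫ θ, q x θ ∂P‖ₑ ≤ eLpNorm (q x) 2 P :=
    (enorm_integral_le_lintegral_enorm _).trans (by
      rw [← eLpNorm_one_eq_lintegral_enorm]
      exact eLpNorm_le_eLpNorm_of_exponent_le (by norm_num) hx)
  calc ‖∫ θ, q x θ ∂P‖ₑ ^ 2 ≤ eLpNorm (q x) 2 P ^ 2 := by gcongr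
    _ = ∫⁻ θ, ‖q x θ‖ₑ ^ 2 ∂P := eLpNorm_two_sq P (q x)

/-- If almost all `q(·, θ)` have `L²` norm at most `K`, so has their average over `θ`. -/
theorem eLpNorm_integral_le {X Θ : Type*} [MeasurableSpace X] [MeasurableSpace Θ]
    {μ : Measure X} [SFinite μ] {P : Measure Θ} [IsProbabilityMeasure P] {q : X → Θ → ℝ}
    (hq : AEStronglyMeasurable (Function.uncurry q) (μ.prod P)) {K : ℝ≥0∞}
    (hK : ∀ᵐ θ ∂P, eLpNorm (fun x => q x θ) 2 μ ≤ K) :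
    eLpNorm (fun x => ∫ θ, q x θ ∂P) 2 μ ≤ K := by
  rw [← ENNReal.pow_le_pow_left_iff (two_ne_zero), eLpNorm_two_sq]
  refine (lintegral_enorm_integral_sq_le hq).trans ?_
  calc ∫⁻ θ, ∫⁻ x, ‖q x θ‖ₑ ^ 2 ∂μ ∂P ≤ ∫⁻ _, K ^ 2 ∂P := by
        refine lintegral_mono_ae ?_
        filter_upwards [hK] with θ hθ
        rw [← eLpNorm_two_sq]
        gcongr
    _ = K ^ 2 := by simp

/-- Translations are continuous in `L²`. -/
theorem tendsto_eLpNorm_translate_sub {f : EucSp n → ℝ} (hf : MemLp f 2 volume) :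
    Tendsto (fun y => eLpNorm (fun x => f (x - y) - f x) 2 volume) (𝓝 0) (𝓝 0) := by
  let g : EucSp n → C(EucSp n, EucSp n) := fun y => ⟨fun x => x - y, by fun_prop⟩
  have hg : Continuous g := ContinuousMap.continuous_of_continuous_uncurry _ (by
    show Continuous fun p : EucSp n × EucSp n => p.2 - p.1
    fun_prop)
  have hgm : ∀ y, MeasurePreserving (g y) volume volume := fun y => measurePreserving_sub_right _ y
  have hc : Continuous fun y => Lp.compMeasurePreserving (g y) (hgm y) hf.toLp :=
    Continuous.compMeasurePreservingLp continuous_const hg hgm (by simp)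
  have h := (hc.tendsto 0).sub_const (hf.toLp)
  have h0 : Lp.compMeasurePreserving (g 0) (hgm 0) hf.toLp = hf.toLp := by
    rw [Lp.toLp_compMeasurePreserving hf (hgm 0)]
    congr 1
    ext x; simp [g]
  rw [h0, sub_self] at h
  have h1 := h.enorm
  simp only [enorm_zero] at h1
  refine h1.congr fun y => ?_
  rw [Lp.toLp_compMeasurePreserving hf (hgm y), ← MemLp.toLp_sub, Lp.enorm_toLp]
  rfl

theorem memLp_comp_add {f : EucSp n → ℝ} (hf : MemLp f 2 volume) (y : EucSp n) :
    MemLp (fun x => f (x + y)) 2 volume :=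
  hf.comp_measurePreserving (measurePreserving_add_right volume y)

theorem eLpNorm_comp_add {f : EucSp n → ℝ} (hf : AEStronglyMeasurable f volume) (y : EucSp n) :
    eLpNorm (fun x => f (x + y)) 2 volume = eLpNorm f 2 volume :=
  eLpNorm_comp_measurePreserving hf (measurePreserving_add_right volume y)

/-- `v` is the weak derivative `∂ᵢu` in `Ω`; integrability of `u` and `v` is assumed separately. -/
def IsWeakPartial (i : Fin n) (Ω : Set (EucSp n)) (u v : EucSp n → ℝ) : Prop :=
  ∀ φ : EucSp n → ℝ, IsTestFn Ω φ → ∫ x in Ω, u x * partialD i φ x = -∫ x in Ω, v x * φ x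

/-- The mollification `ρ * f` by a normalized bump function. -/
noncomputable def mollify (b : ContDiffBump (0 : EucSp n)) (f : EucSp n → ℝ) : EucSp n → ℝ :=
  convolution (b.normed volume) f (ContinuousLinearMap.lsmul ℝ ℝ) volume

theorem mollify_apply (b : ContDiffBump (0 : EucSp n)) (f : EucSp n → ℝ) (x : EucSp n) :
    mollify b f x = ∫ t, b.normed volume t * f (x - t) := rfl

theorem contDiff_mollify (b : ContDiffBump (0 : EucSp n)) {f : EucSp n → ℝ}
    (hf : LocallyIntegrable f volume) : ContDiff ℝ ∞ (mollify b f) :=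
  b.hasCompactSupport_normed.contDiff_convolution_left _ b.contDiff_normed hf

theorem mollify_eq_zero (b : ContDiffBump (0 : EucSp n)) {f : EucSp n → ℝ} {ρ : ℝ}
    (hf : ∀ x ∉ closedBall (0 : EucSp n) ρ, f x = 0) {x : EucSp n}
    (hx : x ∉ closedBall (0 : EucSp n) (ρ + b.rOut)) : mollify b f x = 0 := by
  rw [mollify_apply]
  refine integral_eq_zero_of_ae (.of_forall fun t => ?_)
  by_cases ht : t ∈ ball (0 : EucSp n) b.rOut
  · have : f (x - t) = 0 := hf _ fun h => hx (by
      simp only [mem_closedBall, dist_zero_right, mem_ball] at *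
      calc ‖x‖ = ‖(x - t) + t‖ := by simp
        _ ≤ ‖x - t‖ + ‖t‖ := norm_add_le _ _
        _ ≤ _ := by linarith)
    simp [this]
  · have : b.normed volume t = 0 := by
      rw [← Function.notMem_support, b.support_normed_eq]; exact ht
    simp [this]

theorem isTestFn_mollify (b : ContDiffBump (0 : EucSp n)) {f : EucSp n → ℝ} {ρ R : ℝ}
    (hfi : LocallyIntegrable f volume)
    (hf : ∀ x ∉ closedBall (0 : EucSp n) ρ, f x = 0) (hR : ρ + b.rOut < R) :
    IsTestFn (ball 0 R) (mollify b f) := by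
  have hs : tsupport (mollify b f) ⊆ closedBall 0 (ρ + b.rOut) :=
    closure_minimal (fun x hx => by_contra fun h => hx (mollify_eq_zero b hf h)) isClosed_closedBall
  exact ⟨contDiff_mollify b hfi,
    (isCompact_closedBall 0 _).of_isClosed_subset (isClosed_tsupport _) hs,
    hs.trans (closedBall_subset_ball hR)⟩

/-- Mollification commutes with weak derivatives. -/
theorem partialD_mollify (b : ContDiffBump (0 : EucSp n)) {i : Fin n} {w g : EucSp n → ℝ}
    (hw : LocallyIntegrable w volume) (h : IsWeakPartial i univ w g) :
    partialD i (mollify b w) = mollify b g := by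
  ext x
  have h1 := (b.hasCompactSupport_normed (μ := volume)).hasFDerivAt_convolution_left
    (ContinuousLinearMap.lsmul ℝ ℝ) (b.contDiff_normed (n := 1)) hw x
  set ψ : EucSp n → ℝ := fun y => b.normed volume (x - y) with hψ
  have hψt : IsTestFn univ ψ := by
    refine ⟨b.contDiff_normed.comp (contDiff_const.sub contDiff_id), ?_, subset_univ _⟩
    exact b.hasCompactSupport_normed.comp_homeomorph (Homeomorph.subLeft x)
  have hd : ∀ y, partialD i ψ y = -fderiv ℝ (b.normed volume) (x - y) (coordVec i) := by
    intro y
    have h2 : HasFDerivAt ψ ((fderiv ℝ (b.normed volume) (x - y)).comp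
        (-ContinuousLinearMap.id ℝ (EucSp n))) y := by
      have h3 : DifferentiableAt ℝ (b.normed volume) (x - y) :=
        (b.contDiff_normed (n := 1)).differentiable (by simp) _
      exact h3.hasFDerivAt.comp y ((hasFDerivAt_id y).const_sub x)
    unfold partialD
    rw [h2.fderiv]
    simp
  have h4 := h ψ hψt
  simp only [Measure.restrict_univ, hd, mul_neg, integral_neg, neg_inj] at h4
  unfold partialD mollify
  rw [h1.fderiv, convolution_eq_swap]
  rw [convolution_eq_swap, ContinuousLinearMap.integral_apply]
  · simp only [ContinuousLinearMap.precompL_apply, ContinuousLinearMap.lsmul_apply, smul_eq_mul]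
    simp_rw [mul_comm _ (w _)]
    rw [h4]
    simp [ψ, mul_comm]
  · exact ((b.hasCompactSupport_normed.fderiv ℝ).convolutionExists_left _
      (b.contDiff_normed.continuous_fderiv (n := 1) one_ne_zero) hw x).integrable_swap

/-- `ρ * f - f` is an average of the differences `f(· - t) - f` over small `t`, which are small in
`L²`. -/
theorem tendsto_mollify {b : ℕ → ContDiffBump (0 : EucSp n)}
    (hb : Tendsto (fun k => (b k).rOut) atTop (𝓝 0)) {f : EucSp n → ℝ} (hf : MemLp f 2 volume) :
    Tendsto (fun k => eLpNorm (fun x => mollify (b k) f x - f x) 2 volume) atTop (𝓝 0) := by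
  rw [ENNReal.tendsto_nhds_zero]
  intro ε hε
  obtain ⟨δ, hδ, hδ'⟩ := Metric.eventually_nhds_iff.1
    (ENNReal.tendsto_nhds_zero.1 (tendsto_eLpNorm_translate_sub hf) ε hε)
  filter_upwards [hb.eventually (gt_mem_nhds hδ)] with k hk
  let ρ := (b k).normed volume
  have hρ : ∀ x, 0 ≤ ρ x := fun x => (b k).nonneg_normed x
  have hρm : Measurable fun x => ENNReal.ofReal (ρ x) :=
    ((b k).continuous_normed.measurable).ennreal_ofReal
  -- the averaging measure is the bump function times Lebesgue measure
  let P : Measure (EucSp n) := volume.withDensity fun x => ENNReal.ofReal (ρ x)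
  have hP : IsProbabilityMeasure P := ⟨by
    rw [withDensity_apply _ MeasurableSet.univ, Measure.restrict_univ,
      ← ofReal_integral_eq_lintegral_ofReal (b k).integrable_normed (.of_forall hρ),
      (b k).integral_normed, ENNReal.ofReal_one]⟩
  have hint : ∀ g : EucSp n → ℝ, ∫ t, g t ∂P = ∫ t, ρ t * g t := by
    intro g
    rw [integral_withDensity_eq_integral_toReal_smul hρm (by simp)]
    simp [ENNReal.toReal_ofReal (hρ _)]
  have h1 : ∀ x, mollify (b k) f x - f x = ∫ t, (f (x - t) - f x) ∂P := by
    intro x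
    rw [integral_sub, integral_const, hint]
    · simp; rfl
    · rw [integrable_withDensity_iff_integrable_smul' hρm (by simp)]
      have := ((b k).hasCompactSupport_normed (μ := volume)).convolutionExists_left
        (ContinuousLinearMap.lsmul ℝ ℝ) (b k).continuous_normed
        (hf.locallyIntegrable (by norm_num)) x
      refine this.congr (.of_forall fun t => ?_)
      simp [ENNReal.toReal_ofReal (hρ t), ρ]
    · exact integrable_const _
  simp_rw [h1]
  refine eLpNorm_integral_le ?_ ?_
  · exact (hf.1.comp_quasiMeasurePreserving
      (quasiMeasurePreserving_sub_of_right_invariant volume P)).sub hf.1.comp_fst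
  · refine (ae_withDensity_iff hρm).2 (.of_forall fun t ht => hδ' ?_)
    have ht' : t ∈ Function.support ((b k).normed volume) := by
      intro h; exact ht (by simp [ρ, h])
    rw [(b k).support_normed_eq] at ht'
    exact (mem_ball.1 ht').trans hk

/-- A compactly supported `L²` function is an `L²` limit of test functions whose partial derivatives
converge in `L²` to every weak partial derivative that exists. -/
theorem exists_isTestFn_tendsto {w : EucSp n → ℝ} {ρ R : ℝ} (hρ : ρ < R)
    (hw : MemLp w 2 volume) (hs : ∀ x ∉ closedBall (0 : EucSp n) ρ, w x = 0) :
    ∃ φ : ℕ → EucSp n → ℝ, (∀ k, IsTestFn (ball 0 R) (φ k)) ∧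
      Tendsto (fun k => eLpNorm (fun x => φ k x - w x) 2 volume) atTop (𝓝 0) ∧
      ∀ i g, MemLp g 2 volume → IsWeakPartial i univ w g →
        Tendsto (fun k => eLpNorm (fun x => partialD i (φ k) x - g x) 2 volume) atTop (𝓝 0) := by
  have hc : ∀ k : ℕ, 0 < (R - ρ) / (k + 2) := fun k => by
    have : 0 < R - ρ := sub_pos.2 hρ
    positivity
  let b : ℕ → ContDiffBump (0 : EucSp n) := fun k =>
    ⟨(R - ρ) / (k + 2) / 2, (R - ρ) / (k + 2), half_pos (hc k), half_lt_self (hc k)⟩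
  have hb : Tendsto (fun k => (b k).rOut) atTop (𝓝 0) :=
    tendsto_const_nhds.div_atTop
      (tendsto_atTop_add_const_right _ _ tendsto_natCast_atTop_atTop)
  have hwl : LocallyIntegrable w volume := hw.locallyIntegrable (by norm_num)
  refine ⟨fun k => mollify (b k) w, fun k => isTestFn_mollify (b k) hwl hs ?_,
    tendsto_mollify hb hw, fun i g hg h => ?_⟩
  · have : (R - ρ) / ((k : ℝ) + 2) < R - ρ := by
      refine div_lt_self (sub_pos.2 hρ) ?_
      have : (0 : ℝ) ≤ k := k.cast_nonneg
      linarith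
    show ρ + (R - ρ) / (k + 2) < R
    linarith
  · simp_rw [partialD_mollify _ hwl h]
    exact tendsto_mollify hb hg

/-! ### Weak derivatives: localization, product rule, testing with Sobolev functions -/

theorem memLp_of_memLp_restrict {Ω : Set (EucSp n)} (hΩ : MeasurableSet Ω) {f : EucSp n → ℝ}
    {p : ℝ≥0∞} (hf : MemLp f p (volume.restrict Ω)) (h0 : ∀ x ∉ Ω, f x = 0) :
    MemLp f p volume := by
  have : Ω.indicator f = f := indicator_eq_self.2 fun x hx => by_contra fun h => hx (h0 x h)
  rw [← this]
  exact (memLp_indicator_iff_restrict hΩ).2 hf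

theorem eLpNorm_eq_restrict {Ω : Set (EucSp n)} (hΩ : MeasurableSet Ω) {f : EucSp n → ℝ}
    {p : ℝ≥0∞} (h0 : ∀ x ∉ Ω, f x = 0) :
    eLpNorm f p volume = eLpNorm f p (volume.restrict Ω) := by
  have : Ω.indicator f = f := indicator_eq_self.2 fun x hx => by_contra fun h => hx (h0 x h)
  conv_lhs => rw [← this]
  exact eLpNorm_indicator_eq_eLpNorm_restrict hΩ

namespace IsWeakPartial

variable {i : Fin n} {Ω Ω' : Set (EucSp n)} {u v u' v' : EucSp n → ℝ}

theorem congr (h : IsWeakPartial i Ω u v) (hu : u =ᵐ[volume.restrict Ω] u')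
    (hv : v =ᵐ[volume.restrict Ω] v') : IsWeakPartial i Ω u' v' := by
  intro φ hφ
  rw [← integral_congr_ae (f := fun x => u x * partialD i φ x) (by
      filter_upwards [hu] with x hx; rw [hx]), h φ hφ,
    integral_congr_ae (f := fun x => v x * φ x) (by filter_upwards [hv] with x hx; rw [hx])]

theorem mono (h : IsWeakPartial i Ω u v) (hΩ : Ω' ⊆ Ω) : IsWeakPartial i Ω' u v := by
  intro φ hφ
  have h1 := h φ (hφ.mono hΩ)
  have h2 : ∀ {w ψ : EucSp n → ℝ}, IsTestFn Ω' ψ →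
      ∫ x in Ω, w x * ψ x = ∫ x in Ω', w x * ψ x := fun {w ψ} hψ => by
    rw [setIntegral_eq_integral_of_forall_compl_eq_zero,
      setIntegral_eq_integral_of_forall_compl_eq_zero]
    · intro x hx; rw [hψ.eq_zero hx, mul_zero]
    · intro x hx; rw [hψ.eq_zero fun h => hx (hΩ h), mul_zero]
  rwa [h2 (hφ.partialD i), h2 hφ] at h1

theorem add (h : IsWeakPartial i Ω u v) (h' : IsWeakPartial i Ω u' v')
    (hu : MemLp u 2 (volume.restrict Ω)) (hv : MemLp v 2 (volume.restrict Ω))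
    (hu' : MemLp u' 2 (volume.restrict Ω)) (hv' : MemLp v' 2 (volume.restrict Ω)) :
    IsWeakPartial i Ω (fun x => u x + u' x) (fun x => v x + v' x) := by
  intro φ hφ
  have hp := (hφ.partialD i).memLp 2 (volume.restrict Ω)
  have hq := hφ.memLp 2 (volume.restrict Ω)
  simp_rw [add_mul]
  rw [integral_add (integrable_mul_of_memLp_two hu hp) (integrable_mul_of_memLp_two hu' hp),
    integral_add (integrable_mul_of_memLp_two hv hq) (integrable_mul_of_memLp_two hv' hq),
    h φ hφ, h' φ hφ]
  ring

theorem sum {ι : Type*} (s : Finset ι) {u v : ι → EucSp n → ℝ}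
    (h : ∀ j ∈ s, IsWeakPartial i Ω (u j) (v j))
    (hu : ∀ j ∈ s, MemLp (u j) 2 (volume.restrict Ω))
    (hv : ∀ j ∈ s, MemLp (v j) 2 (volume.restrict Ω)) :
    IsWeakPartial i Ω (fun x => ∑ j ∈ s, u j x) (fun x => ∑ j ∈ s, v j x) := by
  classical
  induction s using Finset.induction_on with
  | empty => intro φ hφ; simp
  | insert a s ha ih =>
    simp_rw [Finset.sum_insert ha]
    simp only [Finset.mem_insert, forall_eq_or_imp] at h hu hv
    exact h.1.add (ih h.2 hu.2 hv.2) hu.1 hv.1 (memLp_finsetSum s hu.2) (memLp_finsetSum s hv.2)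

/-- The product rule for a smooth factor, provided the product with the test function is a test
function in `Ω`. -/
theorem integral_smooth_mul (h : IsWeakPartial i Ω u v)
    (hu : MemLp u 2 (volume.restrict Ω)) (hv : MemLp v 2 (volume.restrict Ω))
    {η φ : EucSp n → ℝ} (hη : ContDiff ℝ ∞ η) (hφ : ContDiff ℝ ∞ φ)
    (ht : IsTestFn Ω η ∨ IsTestFn Ω φ) :
    ∫ x in Ω, (η x * u x) * partialD i φ x =
      -∫ x in Ω, (η x * v x + partialD i η x * u x) * φ x := by
  have t1 : IsTestFn Ω fun x => η x * φ x := ht.elim (·.mul_right hφ) (·.mul_left hη)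
  have t2 : IsTestFn Ω fun x => η x * partialD i φ x :=
    ht.elim (·.mul_right (contDiff_partialD i hφ)) fun h => (h.partialD i).mul_left hη
  have t3 : IsTestFn Ω fun x => partialD i η x * φ x :=
    ht.elim (fun h => (h.partialD i).mul_right hφ) (·.mul_left (contDiff_partialD i hη))
  have i2 := integrable_mul_of_memLp_two hu (t2.memLp 2 (volume.restrict Ω))
  have i3 := integrable_mul_of_memLp_two hu (t3.memLp 2 (volume.restrict Ω))
  have i1 := integrable_mul_of_memLp_two hv (t1.memLp 2 (volume.restrict Ω))
  have h1 := h _ t1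
  have e1 : ∀ x, u x * partialD i (fun x => η x * φ x) x =
      u x * (partialD i η x * φ x) + u x * (η x * partialD i φ x) := fun x => by
    rw [partialD_mul i (hη.differentiable (by simp) x) (hφ.differentiable (by simp) x)]; ring
  simp_rw [e1] at h1
  rw [integral_add i3 i2] at h1
  have e2 : ∀ x, (η x * v x + partialD i η x * u x) * φ x =
      v x * (η x * φ x) + u x * (partialD i η x * φ x) := fun x => by ring
  have e3 : ∀ x, (η x * u x) * partialD i φ x = u x * (η x * partialD i φ x) := fun x => by ring
  simp_rw [e2, e3]
  rw [integral_add i1 i3]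
  linarith

theorem smooth_mul (h : IsWeakPartial i Ω u v)
    (hu : MemLp u 2 (volume.restrict Ω)) (hv : MemLp v 2 (volume.restrict Ω))
    {η : EucSp n → ℝ} (hη : ContDiff ℝ ∞ η) :
    IsWeakPartial i Ω (fun x => η x * u x) (fun x => η x * v x + partialD i η x * u x) :=
  fun _ hφ => h.integral_smooth_mul hu hv hη hφ.1 (.inr hφ)

/-- Multiplication by a test function turns a weak derivative in `Ω` into one in the whole space. -/
theorem test_mul (h : IsWeakPartial i Ω u v)
    (hu : MemLp u 2 (volume.restrict Ω)) (hv : MemLp v 2 (volume.restrict Ω))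
    {η : EucSp n → ℝ} (hη : IsTestFn Ω η) :
    IsWeakPartial i univ (fun x => η x * u x) (fun x => η x * v x + partialD i η x * u x) := by
  intro φ hφ
  have := h.integral_smooth_mul hu hv hη.1 hφ.1 (.inl hη)
  rw [setIntegral_eq_integral_of_forall_compl_eq_zero,
    setIntegral_eq_integral_of_forall_compl_eq_zero] at this
  · simpa using this
  · intro x hx; simp [hη.eq_zero hx, (hη.partialD i).eq_zero hx]
  · intro x hx; simp [hη.eq_zero hx]

end IsWeakPartial

/-- A test function times an `L²(Ω)` function is in `L²(ℝⁿ)`. -/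
theorem IsTestFn.mul_memLp {Ω : Set (EucSp n)} (hΩ : MeasurableSet Ω) {η u : EucSp n → ℝ}
    (hη : IsTestFn Ω η) (hu : MemLp u 2 (volume.restrict Ω)) :
    MemLp (fun x => η x * u x) 2 volume := by
  obtain ⟨C, hC⟩ := hη.exists_bound
  exact memLp_of_memLp_restrict hΩ
    (hu.bdd_mul_two hη.continuous.aestronglyMeasurable (.of_forall hC))
    fun x hx => by rw [hη.eq_zero hx, zero_mul]

theorem IsTestFn.mul_add_memLp {Ω : Set (EucSp n)} (hΩ : MeasurableSet Ω) {η u v : EucSp n → ℝ}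
    (hη : IsTestFn Ω η) (hu : MemLp u 2 (volume.restrict Ω)) (hv : MemLp v 2 (volume.restrict Ω))
    (i : Fin n) : MemLp (fun x => η x * v x + _root_.partialD i η x * u x) 2 volume :=
  (hη.mul_memLp hΩ hv).add ((hη.partialD i).mul_memLp hΩ hu)

/-- A weak identity tested with `C_c^∞` functions may be tested with compactly supported `H¹`
functions. -/
theorem integral_sum_eq_of_forall_isTestFn {R ρ : ℝ} (s : Finset (Fin n))
    {H : Fin n → EucSp n → ℝ} {f : EucSp n → ℝ}
    (hH : ∀ i ∈ s, MemLp (H i) 2 (volume.restrict (ball 0 R)))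
    (hf : MemLp f 2 (volume.restrict (ball 0 R)))
    (h : ∀ φ, IsTestFn (ball 0 R) φ →
      ∫ x in ball 0 R, ∑ i ∈ s, H i x * partialD i φ x = ∫ x in ball 0 R, f x * φ x)
    {w : EucSp n → ℝ} {g : Fin n → EucSp n → ℝ} (hρ : ρ < R) (hw : MemLp w 2 volume)
    (hg : ∀ i ∈ s, MemLp (g i) 2 volume) (hwg : ∀ i ∈ s, IsWeakPartial i univ w (g i))
    (hs : ∀ x ∉ closedBall (0 : EucSp n) ρ, w x = 0) :
    ∫ x in ball 0 R, ∑ i ∈ s, H i x * g i x = ∫ x in ball 0 R, f x * w x := by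
  obtain ⟨φ, hφ, h0, h1⟩ := exists_isTestFn_tendsto hρ hw hs
  have hres : ∀ {q : ℕ → EucSp n → ℝ}, Tendsto (fun k => eLpNorm (q k) 2 volume) atTop (𝓝 0) →
      Tendsto (fun k => eLpNorm (q k) 2 (volume.restrict (ball 0 R))) atTop (𝓝 0) :=
    fun hq => tendsto_of_tendsto_of_tendsto_of_le_of_le tendsto_const_nhds hq
      (fun _ => zero_le) fun _ => eLpNorm_mono_measure _ Measure.restrict_le_self
  have t0 := tendsto_integral_mul_of_tendsto_eLpNorm hf (fun k => (hφ k).memLp 2 _)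
    (hw.restrict _) (hres h0)
  have t1 : Tendsto (fun k => ∑ i ∈ s, ∫ x in ball 0 R, H i x * partialD i (φ k) x) atTop
      (𝓝 (∑ i ∈ s, ∫ x in ball 0 R, H i x * g i x)) :=
    tendsto_finsetSum _ fun i hi => tendsto_integral_mul_of_tendsto_eLpNorm (hH i hi)
      (fun k => ((hφ k).partialD i).memLp 2 _) ((hg i hi).restrict _)
      (hres (h1 i (g i) (hg i hi) (hwg i hi)))
  rw [integral_finsetSum _ fun i hi =>
    integrable_mul_of_memLp_two (hH i hi) ((hg i hi).restrict _)]
  refine tendsto_nhds_unique t1 (t0.congr fun k => ?_)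
  rw [← h _ (hφ k), integral_finsetSum _ fun i hi =>
    integrable_mul_of_memLp_two (hH i hi) (((hφ k).partialD i).memLp 2 _)]

theorem memLp_two_of_bdd {R : ℝ} {a : EucSp n → ℝ} {M : ℝ≥0}
    (ha : AEStronglyMeasurable a (volume.restrict (ball 0 R)))
    (hM : ∀ᵐ x ∂volume.restrict (ball (0 : EucSp n) R), |a x| ≤ M) :
    MemLp a 2 (volume.restrict (ball 0 R)) := by
  have : IsFiniteMeasure (volume.restrict (ball (0 : EucSp n) R)) :=
    ⟨by rw [Measure.restrict_apply_univ]; exact measure_ball_lt_top⟩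
  exact MemLp.of_bound ha M hM

/-- The product rule for a `W^{1,∞}` function and an `H¹` function in a ball. -/
theorem IsWeakPartial.bdd_mul {i : Fin n} {R : ℝ} {a b u v : EucSp n → ℝ} {M N : ℝ≥0}
    (hab : IsWeakPartial i (ball 0 R) a b) (huv : IsWeakPartial i (ball 0 R) u v)
    (ha : AEStronglyMeasurable a (volume.restrict (ball 0 R)))
    (haM : ∀ᵐ x ∂volume.restrict (ball (0 : EucSp n) R), |a x| ≤ M)
    (hb : AEStronglyMeasurable b (volume.restrict (ball 0 R)))
    (hbN : ∀ᵐ x ∂volume.restrict (ball (0 : EucSp n) R), |b x| ≤ N)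
    (hu : MemLp u 2 (volume.restrict (ball 0 R))) (hv : MemLp v 2 (volume.restrict (ball 0 R))) :
    IsWeakPartial i (ball 0 R) (fun x => a x * u x) (fun x => b x * u x + a x * v x) := by
  intro φ hφ
  have ha2 := memLp_two_of_bdd ha haM
  have hb2 := memLp_two_of_bdd hb hbN
  obtain ⟨ρ, hρ, hs⟩ := hφ.exists_closedBall
  -- test the weak derivative of `u` with the compactly supported `H¹` function `φa`
  have key := integral_sum_eq_of_forall_isTestFn {i} (H := fun _ => u) (f := fun x => -v x)
    (g := fun i x => φ x * b x + partialD i φ x * a x) (w := fun x => φ x * a x)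
    (fun _ _ => hu) hv.neg
    (fun ψ hψ => by simpa [integral_neg] using huv ψ hψ) hρ (hφ.mul_memLp measurableSet_ball ha2)
    (fun j _ => hφ.mul_add_memLp measurableSet_ball ha2 hb2 j)
    (fun j hj => by
      rw [Finset.mem_singleton.1 hj]; exact hab.test_mul ha2 hb2 hφ)
    (fun x hx => by simp [hs x hx])
  simp only [Finset.sum_singleton] at key
  have q1 := hφ.memLp 2 (volume.restrict (ball 0 R))
  have q2 := (hφ.partialD i).memLp 2 (volume.restrict (ball 0 R))
  have i1 := integrable_mul_of_memLp_two (hu.bdd_mul_two hb hbN) q1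
  have i2 := integrable_mul_of_memLp_two (hu.bdd_mul_two ha haM) q2
  have i3 := integrable_mul_of_memLp_two (hv.bdd_mul_two ha haM) q1
  have e1 : ∀ x, u x * (φ x * b x + partialD i φ x * a x) =
    (b x * u x) * φ x + (a x * u x) * partialD i φ x := fun x => by ring
  have e2 : ∀ x, -v x * (φ x * a x) = -((a x * v x) * φ x) := fun x => by ring
  simp_rw [e1, e2] at key
  rw [integral_add i1 i2, integral_neg] at key
  simp_rw [add_mul]
  rw [integral_add i1 i3]
  linarith

/-! ### Difference quotients -/

/-- The difference of `φ` is an average of translates of `h ∂ₗφ`, whose `L²` norms are all equal. -/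
theorem IsTestFn.eLpNorm_translate_sub_le {Ω : Set (EucSp n)} {φ : EucSp n → ℝ}
    (hφ : IsTestFn Ω φ) (l : Fin n) (h : ℝ) :
    eLpNorm (fun x => φ (x + h • coordVec l) - φ x) 2 volume ≤
      ‖h‖ₑ * eLpNorm (_root_.partialD l φ) 2 volume := by
  let P : Measure ℝ := volume.restrict (Ioc 0 1)
  have hP : IsProbabilityMeasure P := ⟨by simp [P]⟩
  have hc : Continuous (_root_.partialD l φ) := (hφ.partialD l).continuous
  have h1 : ∀ x, φ (x + h • coordVec l) - φ x =
      ∫ θ, h * _root_.partialD l φ (x + (θ * h) • coordVec l) ∂P := by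
    intro x
    have hd : ∀ θ : ℝ, HasDerivAt (fun θ : ℝ => φ (x + (θ * h) • coordVec l))
        (h * _root_.partialD l φ (x + (θ * h) • coordVec l)) θ := by
      intro θ
      have h2 : HasDerivAt (fun θ : ℝ => x + (θ * h) • coordVec l) (h • coordVec l) θ := by
        simpa using (((hasDerivAt_id θ).mul_const h).smul_const (coordVec l)).const_add x
      have := (hφ.differentiable (x + (θ * h) • coordVec l)).hasFDerivAt.comp_hasDerivAt θ h2
      rw [ContinuousLinearMap.map_smul, smul_eq_mul] at this
      exact this
    have := intervalIntegral.integral_eq_sub_of_hasDerivAt (a := 0) (b := 1) (fun θ _ => hd θ)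
      (Continuous.intervalIntegrable (by fun_prop) _ _)
    rw [intervalIntegral.integral_of_le zero_le_one] at this
    rw [this]
    simp
  simp_rw [h1]
  refine eLpNorm_integral_le ?_ (.of_forall fun θ => ?_)
  · refine Continuous.aestronglyMeasurable ?_
    show Continuous fun p : EucSp n × ℝ => h * _root_.partialD l φ (p.1 + (p.2 * h) • coordVec l)
    fun_prop
  · rw [← eLpNorm_comp_add (f := _root_.partialD l φ) hc.aestronglyMeasurable
      ((θ * h) • coordVec l)]
    exact (eLpNorm_const_smul h (fun x => _root_.partialD l φ (x + (θ * h) • coordVec l)) 2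
      volume).le

/-- The `L²` norm of a difference of a compactly supported `H¹` function is controlled by the weak
derivative. -/
theorem eLpNorm_translate_sub_le {w g : EucSp n → ℝ} {l : Fin n} {ρ : ℝ}
    (hw : MemLp w 2 volume) (hg : MemLp g 2 volume) (hwg : IsWeakPartial l univ w g)
    (hs : ∀ x ∉ closedBall (0 : EucSp n) ρ, w x = 0) (h : ℝ) :
    eLpNorm (fun x => w (x + h • coordVec l) - w x) 2 volume ≤ ‖h‖ₑ * eLpNorm g 2 volume := by
  obtain ⟨φ, hφ, h0, h1⟩ := exists_isTestFn_tendsto (lt_add_one ρ) hw hs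
  have h1 := h1 l g hg hwg
  have hlim : Tendsto (fun k => ‖h‖ₑ * (eLpNorm g 2 volume +
      eLpNorm (fun x => partialD l (φ k) x - g x) 2 volume) +
      (eLpNorm (fun x => φ k x - w x) 2 volume + eLpNorm (fun x => φ k x - w x) 2 volume)) atTop
      (𝓝 (‖h‖ₑ * (eLpNorm g 2 volume + 0) + (0 + 0))) :=
    (ENNReal.Tendsto.const_mul (h1.const_add _) (.inr enorm_ne_top)).add (h0.add h0)
  rw [add_zero, add_zero, add_zero] at hlim
  refine ge_of_tendsto hlim (.of_forall fun k => ?_)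
  have hk : MemLp (φ k) 2 volume := (hφ k).memLp 2 _
  have hdk : MemLp (partialD l (φ k)) 2 volume := ((hφ k).partialD l).memLp 2 _
  have hd : MemLp (fun x => φ k x - w x) 2 volume := hk.sub hw
  have e : (fun x => w (x + h • coordVec l) - w x) =
      (fun x => φ k (x + h • coordVec l) - φ k x) +
        ((fun x => φ k x - w x) - fun x => φ k (x + h • coordVec l) - w (x + h • coordVec l)) := by
    ext x; simp only [Pi.add_apply, Pi.sub_apply]; ring
  have e2 : partialD l (φ k) = g + fun x => partialD l (φ k) x - g x := by ext x; simp
  rw [e]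
  refine (eLpNorm_add_le ((memLp_comp_add hk _).sub hk).1 (hd.sub (memLp_comp_add hd _)).1
    (by norm_num)).trans (add_le_add ?_ ?_)
  · refine ((hφ k).eLpNorm_translate_sub_le l h).trans ?_
    gcongr
    conv_lhs => rw [e2]
    exact eLpNorm_add_le hg.1 (hdk.sub hg).1 (by norm_num)
  · refine (eLpNorm_sub_le hd.1 (memLp_comp_add hd _).1 (by norm_num)).trans ?_
    gcongr
    exact (eLpNorm_comp_add hd.1 _).le

/-- Bounded sequences in a Hilbert space have weak cluster points. -/
theorem exists_forall_tendsto_inner_eq {H : Type*} [NormedAddCommGroup H] [InnerProductSpace ℝ H]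
    [CompleteSpace H] {x : ℕ → H} {K : ℝ} (hK : ∀ k, ‖x k‖ ≤ K) :
    ∃ y : H, ‖y‖ ≤ K ∧ ∀ (v : H) (c : ℝ), Tendsto (fun k => inner ℝ (x k) v) atTop (𝓝 c) →
      inner ℝ y v = c := by
  let U : Ultrafilter ℕ := Ultrafilter.of atTop
  have hU : (U : Filter ℕ) ≤ atTop := Ultrafilter.of_le atTop
  have hb : ∀ v k, ‖inner ℝ (x k) v‖ ≤ K * ‖v‖ := fun v k =>
    (norm_inner_le_norm _ _).trans (by gcongr; exact hK k)
  have hlim : ∀ v, ∃ c, Tendsto (fun k => inner ℝ (x k) v) U (𝓝 c) ∧ ‖c‖ ≤ K * ‖v‖ := by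
    intro v
    obtain ⟨c, hc, hcU⟩ := (isCompact_closedBall (0 : ℝ) (K * ‖v‖)).ultrafilter_le_nhds
      (U.map fun k => inner ℝ (x k) v) (by
        rw [Ultrafilter.coe_map, le_principal_iff]
        exact Filter.mem_map.2 (univ_mem' fun k => by simpa using hb v k))
    exact ⟨c, hcU, by simpa using hc⟩
  choose ℓ hℓ hℓb using hlim
  let L : H →ₗ[ℝ] ℝ :=
    { toFun := ℓ
      map_add' := fun v w => tendsto_nhds_unique (hℓ (v + w)) (by
        simpa [inner_add_right] using (hℓ v).add (hℓ w))
      map_smul' := fun a v => tendsto_nhds_unique (hℓ (a • v)) (by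
        simpa [inner_smul_right] using (hℓ v).const_mul a) }
  let y := (InnerProductSpace.toDual ℝ H).symm (L.mkContinuous K hℓb)
  refine ⟨y, ?_, fun v c hc => ?_⟩
  · rw [LinearIsometryEquiv.norm_map]
    exact LinearMap.mkContinuous_norm_le _ ((norm_nonneg _).trans (hK 0)) _
  · rw [InnerProductSpace.toDual_symm_apply]
    exact tendsto_nhds_unique (hℓ v) (hc.mono_left hU)

/-- A compactly supported `L²` function whose difference quotients are bounded in `L²` has a weak
derivative, with the same bound. -/
theorem exists_isWeakPartial_of_translate_bound {f : EucSp n → ℝ} {l : Fin n} {ρ h₀ K : ℝ}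
    (hh₀ : 0 < h₀) (hf : MemLp f 2 volume) (hs : ∀ x ∉ closedBall (0 : EucSp n) ρ, f x = 0)
    (hK : ∀ h, 0 < h → h < h₀ →
      (eLpNorm (fun x => f (x + h • coordVec l) - f x) 2 volume).toReal ≤ h * K) :
    ∃ G : EucSp n → ℝ, MemLp G 2 volume ∧ (eLpNorm G 2 volume).toReal ≤ K ∧
      IsWeakPartial l univ f G := by
  let t : ℕ → ℝ := fun k => h₀ / (k + 2)
  have ht0 : ∀ k, 0 < t k := fun k => by positivity
  have ht1 : ∀ k, t k < h₀ := fun k => div_lt_self hh₀ (by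
    have : (0 : ℝ) ≤ k := k.cast_nonneg
    linarith)
  have ht : Tendsto t atTop (𝓝[>] 0) := tendsto_nhdsWithin_iff.2
    ⟨tendsto_const_nhds.div_atTop (tendsto_atTop_add_const_right _ _ tendsto_natCast_atTop_atTop),
      .of_forall ht0⟩
  have hd : ∀ k, MemLp (fun x => f (x + t k • coordVec l) - f x) 2 volume :=
    fun k => (memLp_comp_add hf _).sub hf
  obtain ⟨y, hy, hyl⟩ := exists_forall_tendsto_inner_eq (x := fun k => (t k)⁻¹ • (hd k).toLp)
    (K := K) (fun k => by
      rw [norm_smul, Lp.norm_toLp, norm_inv, Real.norm_of_nonneg (ht0 k).le,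
        inv_mul_le_iff₀ (ht0 k)]
      exact hK _ (ht0 k) (ht1 k))
  refine ⟨y, Lp.memLp y, by simpa [Lp.norm_def] using hy, fun φ hφ => ?_⟩
  have hφ2 := hφ.memLp 2 volume
  have hinner : ∀ z : Lp ℝ 2 (volume : Measure (EucSp n)),
      inner ℝ z hφ2.toLp = ∫ x, z x * φ x := fun z => by
    rw [L2.inner_def]
    refine integral_congr_ae ?_
    filter_upwards [hφ2.coeFn_toLp] with x hx
    simp [hx, mul_comm]
  obtain ⟨C, hC⟩ := hφ.1.lipschitzWith_of_hasCompactSupport hφ.2.1 (by simp)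
  have hfi : Integrable f volume := by
    have h1 : IntegrableOn f (closedBall 0 ρ) :=
      (hf.locallyIntegrable (by norm_num)).integrableOn_isCompact (isCompact_closedBall 0 ρ)
    exact (integrableOn_iff_integrable_of_support_subset fun x hx =>
      by_contra fun h' => hx (hs x h')).1 h1
  have hlim := (hC.integral_inv_smul_sub_mul_tendsto_integral_lineDeriv_mul hfi
    (-coordVec l)).comp ht
  have hkey := hyl hφ2.toLp _ (hlim.congr fun k => ?_)
  · rw [hinner] at hkey
    simp only [Measure.restrict_univ]
    rw [hkey, ← integral_neg]
    refine integral_congr_ae (.of_forall fun x => ?_)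
    have : lineDeriv ℝ φ x (-coordVec l) = -partialD l φ x := by
      rw [(hφ.differentiable x).lineDeriv_eq_fderiv]
      simp [partialD]
    simp only [this]; ring
  · rw [inner_smul_left, hinner]
    simp only [Function.comp_apply, smul_eq_mul, conj_trivial, mul_assoc, integral_const_mul]
    congr 1
    have i1 : Integrable (fun x => f x * φ x) := integrable_mul_of_memLp_two hf hφ2
    have i2 : Integrable (fun x => f (x + t k • coordVec l) * φ x) :=
      integrable_mul_of_memLp_two (memLp_comp_add hf _) hφ2
    have i3 : Integrable (fun x => f x * φ (x + t k • -coordVec l)) :=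
      integrable_mul_of_memLp_two hf (memLp_comp_add hφ2 _)
    have e1 : ∫ x, ((hd k).toLp) x * φ x = ∫ x, (f (x + t k • coordVec l) * φ x - f x * φ x) := by
      refine integral_congr_ae ?_
      filter_upwards [(hd k).coeFn_toLp] with x hx
      rw [hx]; ring
    have e2 : ∀ x, (φ (x + t k • -coordVec l) - φ x) * f x =
      f x * φ (x + t k • -coordVec l) - f x * φ x := fun x => by ring
    rw [e1]
    simp_rw [e2]
    rw [integral_sub i3 i1, integral_sub i2 i1,
      ← integral_add_right_eq_self (fun x => f x * φ (x + t k • -coordVec l)) (t k • coordVec l)]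
    simp

/-! ### The energy estimate -/

/-- Uniform ellipticity `λ|ξ|² ≤ ∑ᵢⱼ aᵢⱼ(x)ξⱼξᵢ` in `Ω`. -/
def IsEllipticOn (lam : ℝ) (Ω : Set (EucSp n)) (a : Fin n → Fin n → EucSp n → ℝ) : Prop :=
  ∀ x ∈ Ω, ∀ ξ : Fin n → ℝ, lam * ∑ i, ξ i ^ 2 ≤ ∑ i, (∑ j, a i j x * ξ j) * ξ i

/-- The flux `∑ⱼ aᵢⱼgⱼ + fᵢ`, that is `A∇u + F` when `g` is the gradient of `u`. -/
def flux (a : Fin n → Fin n → EucSp n → ℝ) (g f : Fin n → EucSp n → ℝ) (i : Fin n) (x : EucSp n) :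
    ℝ :=
  ∑ j, a i j x * g j x + f i x

/-- The field `H` is divergence free in `Ω` in the weak sense. -/
def IsWeakDivFree (Ω : Set (EucSp n)) (H : Fin n → EucSp n → ℝ) : Prop :=
  ∀ φ : EucSp n → ℝ, IsTestFn Ω φ → ∫ x in Ω, ∑ i, H i x * partialD i φ x = 0

theorem flux_memLp {Ω : Set (EucSp n)} {a : Fin n → Fin n → EucSp n → ℝ}
    {g f : Fin n → EucSp n → ℝ} {M : ℝ≥0}
    (ha : ∀ i j, AEStronglyMeasurable (a i j) (volume.restrict Ω))
    (haM : ∀ i j, ∀ᵐ x ∂volume.restrict Ω, |a i j x| ≤ M)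
    (hg : ∀ i, MemLp (g i) 2 (volume.restrict Ω)) (hf : ∀ i, MemLp (f i) 2 (volume.restrict Ω))
    (i : Fin n) : MemLp (flux a g f i) 2 (volume.restrict Ω) :=
  (memLp_finsetSum _ fun j _ => (hg j).bdd_mul_two (ha i j) (haM i j)).add (hf i)

/-- The pointwise inequality behind the energy estimate; `t` stands for the value of the cut-off
function and `d` for its gradient. -/
theorem caccioppoli_pointwise {lam s D L t u : ℝ} (hlam : 0 < lam) (hs : 0 < s)
    (hns : n * s ≤ lam / 4) (ht0 : 0 ≤ t) (ht1 : t ≤ 1) {a : Fin n → Fin n → ℝ}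
    {d g f : Fin n → ℝ} (hd : ∀ i, |d i| ≤ D) (ha : ∀ i j, |a i j| ≤ L)
    (hell : lam * ∑ i, g i ^ 2 ≤ ∑ i, (∑ j, a i j * g j) * g i) :
    lam / 2 * ∑ i, (t * g i) ^ 2 ≤
      ∑ i, (∑ j, a i j * g j + f i) * (t * t * g i + (d i * t + t * d i) * u) +
        (n * (n * ((L * D) ^ 2 / s)) + n * D ^ 2) * u ^ 2 + (1 + 1 / lam) * ∑ i, f i ^ 2 := by
  have hcross : ∀ i j, 0 ≤ a i j * g j * (2 * t * d i * u) + s * (t * g j) ^ 2 +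
      (L * D) ^ 2 / s * u ^ 2 := by
    intro i j
    have h1 : (a i j * d i) ^ 2 ≤ (L * D) ^ 2 := by
      rw [← sq_abs, abs_mul]
      have := (abs_nonneg _).trans (ha i j)
      exact pow_le_pow_left₀ (by positivity)
        (mul_le_mul (ha i j) (hd i) (abs_nonneg _) this) 2
    have h2 : (a i j * d i) ^ 2 / s * u ^ 2 ≤ (L * D) ^ 2 / s * u ^ 2 := by gcongr
    have h3 : 0 ≤ (s * (t * g j) + a i j * d i * u) ^ 2 / s := by positivity
    have h4 : (s * (t * g j) + a i j * d i * u) ^ 2 / s =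
      a i j * g j * (2 * t * d i * u) + s * (t * g j) ^ 2 + (a i j * d i) ^ 2 / s * u ^ 2 := by
      field_simp; ring
    linarith
  have hlow : ∀ i, 0 ≤ f i * (t * t * g i + (d i * t + t * d i) * u) + lam / 4 * (t * g i) ^ 2 +
      D ^ 2 * u ^ 2 + (1 + 1 / lam) * f i ^ 2 := by
    intro i
    have ht2 : t ^ 2 ≤ 1 := pow_le_one₀ ht0 ht1
    have h1 : 0 ≤ (lam / 2 * (t * g i) + t * f i) ^ 2 / lam := by positivity
    have h2 : (lam / 2 * (t * g i) + t * f i) ^ 2 / lam =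
      lam / 4 * (t * g i) ^ 2 + f i * (t * t * g i) + t ^ 2 * (f i ^ 2 / lam) := by
      field_simp; ring
    have h3 : t ^ 2 * (f i ^ 2 / lam) ≤ f i ^ 2 / lam :=
      mul_le_of_le_one_left (by positivity) ht2
    have h4 : 0 ≤ (t * f i + d i * u) ^ 2 := sq_nonneg _
    have h5 : t ^ 2 * f i ^ 2 ≤ f i ^ 2 := mul_le_of_le_one_left (by positivity) ht2
    have h6 : d i ^ 2 * u ^ 2 ≤ D ^ 2 * u ^ 2 := by
      gcongr ?_ * _
      exact sq_le_sq' (by linarith [neg_abs_le (d i), hd i]) ((le_abs_self _).trans (hd i))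
    have h7 : (1 + 1 / lam) * f i ^ 2 = f i ^ 2 + f i ^ 2 / lam := by ring
    nlinarith
  have hc := Finset.sum_nonneg fun i (_ : i ∈ Finset.univ) =>
    Finset.sum_nonneg fun j (_ : j ∈ Finset.univ) => hcross i j
  have hl := Finset.sum_nonneg fun i (_ : i ∈ Finset.univ) => hlow i
  simp only [Finset.sum_add_distrib, Finset.sum_const, Finset.card_univ, Fintype.card_fin,
    nsmul_eq_mul, ← Finset.mul_sum] at hc hl
  have hell' : lam * ∑ i, (t * g i) ^ 2 ≤ t ^ 2 * ∑ i, (∑ j, a i j * g j) * g i := by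
    have : ∑ i, (t * g i) ^ 2 = t ^ 2 * ∑ i, g i ^ 2 := by
      rw [Finset.mul_sum]; exact Finset.sum_congr rfl fun i _ => by ring
    rw [this, mul_left_comm]
    gcongr
  have hexp : ∑ i, (∑ j, a i j * g j + f i) * (t * t * g i + (d i * t + t * d i) * u) =
      t ^ 2 * ∑ i, (∑ j, a i j * g j) * g i + ∑ i, ∑ j, a i j * g j * (2 * t * d i * u) +
      ∑ i, f i * (t * t * g i + (d i * t + t * d i) * u) := by
    rw [Finset.mul_sum, ← Finset.sum_add_distrib, ← Finset.sum_add_distrib]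
    refine Finset.sum_congr rfl fun i _ => ?_
    rw [← Finset.sum_mul]
    ring
  have hS : 0 ≤ ∑ i, (t * g i) ^ 2 := Finset.sum_nonneg fun i _ => sq_nonneg _
  have hn : (n * s) * ∑ i, (t * g i) ^ 2 ≤ lam / 4 * ∑ i, (t * g i) ^ 2 := by gcongr
  rw [hexp]
  nlinarith

/-- **Caccioppoli's inequality**: the gradient of a weak solution of `div(A∇u + F) = 0` is bounded
in `L²` of a smaller ball by `u` and `F`. -/
theorem exists_caccioppoli (n : ℕ) {lam : ℝ} (hlam : 0 < lam) (M : ℝ≥0) {r R : ℝ} (hr : 0 < r)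
    (hrR : r < R) :
    ∃ C : ℝ≥0, ∀ (a : Fin n → Fin n → EucSp n → ℝ) (u : EucSp n → ℝ) (g f : Fin n → EucSp n → ℝ)
      (K : ℝ≥0), IsEllipticOn lam (ball 0 R) a →
      (∀ i j, AEStronglyMeasurable (a i j) (volume.restrict (ball 0 R))) →
      (∀ i j, ∀ᵐ x ∂volume.restrict (ball (0 : EucSp n) R), |a i j x| ≤ M) →
      MemLp u 2 (volume.restrict (ball 0 R)) → eLpNorm u 2 (volume.restrict (ball 0 R)) ≤ K →
      (∀ i, MemLp (g i) 2 (volume.restrict (ball 0 R))) →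
      (∀ i, IsWeakPartial i (ball 0 R) u (g i)) →
      (∀ i, MemLp (f i) 2 (volume.restrict (ball 0 R))) →
      (∀ i, eLpNorm (f i) 2 (volume.restrict (ball 0 R)) ≤ K) →
      IsWeakDivFree (ball 0 R) (flux a g f) →
      ∀ i, eLpNorm (g i) 2 (volume.restrict (ball 0 r)) ≤ ↑(C * K) := by
  obtain ⟨η, hη, hη1, hη01⟩ := exists_cutoff (n := n) hr hrR
  have hDi : ∀ i, ∃ D : ℝ≥0, ∀ x, |partialD i η x| ≤ D := fun i => (hη.partialD i).exists_bound
  choose D' hD' using hDi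
  set D : ℝ≥0 := ∑ i, D' i
  have hD : ∀ i x, |partialD i η x| ≤ D := fun i x => (hD' i x).trans (by
    exact_mod_cast Finset.single_le_sum (f := D') (fun _ _ => zero_le) (Finset.mem_univ i))
  -- `s` is the weight in Young's inequality for the `n²` cross terms
  set s : ℝ := lam / (4 * (n + 1))
  have hs : 0 < s := by positivity
  have hns : n * s ≤ lam / 4 := by
    have : (n : ℝ) * s = lam / 4 * (n / (n + 1)) := by simp only [s]; field_simp
    rw [this]
    exact mul_le_of_le_one_right (by positivity) ((div_le_one (by positivity)).2 (by linarith))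
  set C1 : ℝ := n * (n * ((M * D) ^ 2 / s)) + n * D ^ 2
  set C2 : ℝ := 1 + 1 / lam
  have hC1 : 0 ≤ C1 := by positivity
  have hC2 : 0 ≤ C2 := by positivity
  refine ⟨(Real.sqrt (2 / lam * (C1 + n * C2))).toNNReal,
    fun a u g f K hell ha haM hu huK hg hug hf hfK hdiv i => ?_⟩
  have hη2 : IsTestFn (ball 0 R) fun x => η x * η x := hη.mul_left hη.1
  have hpη : ∀ i x, partialD i (fun x => η x * η x) x =
      partialD i η x * η x + η x * partialD i η x := fun i x =>
    partialD_mul i (hη.differentiable x) (hη.differentiable x)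
  obtain ⟨ρ, hρ, hρ0⟩ := hη2.exists_closedBall
  have hP := flux_memLp ha haM hg hf
  have hT : ∀ i, MemLp (fun x => η x * η x * g i x + partialD i (fun x => η x * η x) x * u x) 2
      volume := fun i => hη2.mul_add_memLp measurableSet_ball hu (hg i) i
  -- test the equation with `η²u`
  have key := integral_sum_eq_of_forall_isTestFn Finset.univ (f := fun _ => 0) (fun i _ => hP i)
    (MemLp.zero' (μ := volume.restrict (ball (0 : EucSp n) R)))
    (fun φ hφ => by simpa using hdiv φ hφ) hρ (hη2.mul_memLp measurableSet_ball hu)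
    (fun i _ => hT i) (fun i _ => (hug i).test_mul hu (hg i) hη2) (fun x hx => by simp [hρ0 x hx])
  simp only [zero_mul, integral_zero] at key
  have hηg : ∀ i, MemLp (fun x => η x * g i x) 2 (volume.restrict (ball 0 R)) :=
    fun i => (hη.mul_memLp measurableSet_ball (hg i)).restrict _
  have iG : Integrable (fun x => ∑ i, (η x * g i x) ^ 2) (volume.restrict (ball 0 R)) :=
    integrable_finsetSum _ fun i _ => (hηg i).integrable_sq
  have iT : Integrable (fun x => ∑ i, flux a g f i x *
      (η x * η x * g i x + partialD i (fun x => η x * η x) x * u x)) (volume.restrict (ball 0 R)) :=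
    integrable_finsetSum _ fun i _ => integrable_mul_of_memLp_two (hP i) ((hT i).restrict _)
  have iF : Integrable (fun x => ∑ i, f i x ^ 2) (volume.restrict (ball 0 R)) :=
    integrable_finsetSum _ fun i _ => (hf i).integrable_sq
  have iU : Integrable (fun x => C1 * u x ^ 2) (volume.restrict (ball 0 R)) :=
    hu.integrable_sq.const_mul _
  have iTU : Integrable (fun x => ∑ i, flux a g f i x *
      (η x * η x * g i x + partialD i (fun x => η x * η x) x * u x) + C1 * u x ^ 2)
      (volume.restrict (ball 0 R)) := iT.add iU
  have hmono : ∫ x in ball 0 R, lam / 2 * ∑ i, (η x * g i x) ^ 2 ≤ ∫ x in ball 0 R,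
      (∑ i, flux a g f i x * (η x * η x * g i x + partialD i (fun x => η x * η x) x * u x) +
        C1 * u x ^ 2 + C2 * ∑ i, f i x ^ 2) := by
    refine integral_mono_ae (iG.const_mul _)
      (iTU.add (iF.const_mul _)) ?_
    have hall : ∀ᵐ x ∂volume.restrict (ball (0 : EucSp n) R), ∀ i j, |a i j x| ≤ M :=
      ae_all_iff.2 fun i => ae_all_iff.2 fun j => haM i j
    filter_upwards [hall, ae_restrict_mem measurableSet_ball] with x hx hxR
    simp_rw [hpη]
    exact caccioppoli_pointwise hlam hs hns (hη01 x).1 (hη01 x).2 (fun i => hD i x) hx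
      (hell x hxR fun i => g i x)
  rw [integral_add iTU (iF.const_mul _), integral_add iT iU, key, integral_const_mul,
    integral_const_mul, integral_const_mul,
    integral_finsetSum _ fun i _ => (hf i).integrable_sq] at hmono
  have hsqle : ∀ {v : EucSp n → ℝ}, MemLp v 2 (volume.restrict (ball 0 R)) →
      eLpNorm v 2 (volume.restrict (ball 0 R)) ≤ K → ∫ x in ball 0 R, v x ^ 2 ≤ (K : ℝ) ^ 2 := by
    intro v hv hvK
    rw [← toReal_eLpNorm_two_sq hv]
    gcongr
    exact ENNReal.toReal_le_coe_of_le_coe hvK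
  have hu' := hsqle hu huK
  have hf' : ∑ i, ∫ x in ball 0 R, f i x ^ 2 ≤ n * (K : ℝ) ^ 2 := by
    calc _ ≤ ∑ _i : Fin n, (K : ℝ) ^ 2 := Finset.sum_le_sum fun i _ => hsqle (hf i) (hfK i)
      _ = _ := by simp
  have hgi : ∫ x in ball 0 r, g i x ^ 2 ≤ ∫ x in ball 0 R, ∑ i, (η x * g i x) ^ 2 := by
    calc ∫ x in ball 0 r, g i x ^ 2 ≤ ∫ x in ball 0 r, ∑ i, (η x * g i x) ^ 2 := by
          refine setIntegral_mono_on
            ((hg i).integrable_sq.mono_measure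
              (Measure.restrict_mono (ball_subset_ball hrR.le) le_rfl))
            (iG.mono_measure (Measure.restrict_mono (ball_subset_ball hrR.le) le_rfl))
            measurableSet_ball fun x hx => ?_
          simp_rw [hη1 x hx, one_mul]
          exact Finset.single_le_sum (f := fun i => g i x ^ 2) (fun _ _ => sq_nonneg _)
            (Finset.mem_univ i)
      _ ≤ _ := setIntegral_mono_set iG
          (.of_forall fun x => Finset.sum_nonneg fun i _ => sq_nonneg _)
          (ball_subset_ball hrR.le).eventuallyLE
  have hgr : MemLp (g i) 2 (volume.restrict (ball 0 r)) :=
    (hg i).mono_measure (Measure.restrict_mono (ball_subset_ball hrR.le) le_rfl)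
  refine eLpNorm_two_le_of_integral_sq_le hgr ?_
  have hpos : 0 ≤ 2 / lam * (C1 + n * C2) := by positivity
  rw [ENNReal.coe_toReal, NNReal.coe_mul, mul_pow, Real.coe_toNNReal _ (Real.sqrt_nonneg _),
    Real.sq_sqrt hpos]
  have h1 : lam / 2 * ∫ x in ball 0 R, ∑ i, (η x * g i x) ^ 2 ≤ (C1 + n * C2) * (K : ℝ) ^ 2 := by
    have q1 : C1 * ∫ x in ball 0 R, u x ^ 2 ≤ C1 * (K : ℝ) ^ 2 := by gcongr
    have q2 : C2 * ∑ i, ∫ x in ball 0 R, f i x ^ 2 ≤ C2 * (n * (K : ℝ) ^ 2) := by gcongr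
    linarith
  refine hgi.trans ?_
  have h2 : ∫ x in ball 0 R, ∑ i, (η x * g i x) ^ 2 =
      2 / lam * (lam / 2 * ∫ x in ball 0 R, ∑ i, (η x * g i x) ^ 2) := by field_simp
  rw [h2, mul_assoc]
  gcongr

/-! ### Second derivatives by difference quotients -/

theorem IsWeakPartial.comp_add {i : Fin n} {w g : EucSp n → ℝ} (h : IsWeakPartial i univ w g)
    (y : EucSp n) : IsWeakPartial i univ (fun x => w (x + y)) (fun x => g (x + y)) := by
  intro φ hφ
  have hψ : IsTestFn univ fun x => φ (x - y) :=
    ⟨hφ.1.comp (contDiff_id.sub contDiff_const),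
      hφ.2.1.comp_homeomorph (Homeomorph.subRight y), subset_univ _⟩
  have hd : ∀ x, partialD i (fun x => φ (x - y)) x = partialD i φ (x - y) := fun x => by
    unfold partialD
    rw [fderiv_comp_sub]
  have := h _ hψ
  simp only [Measure.restrict_univ, hd] at this ⊢
  rw [← integral_add_right_eq_self _ y, ← integral_add_right_eq_self (fun x => g x * _) y] at this
  simpa using this

theorem IsWeakPartial.sub {i : Fin n} {Ω : Set (EucSp n)} {u v u' v' : EucSp n → ℝ}
    (h : IsWeakPartial i Ω u v) (h' : IsWeakPartial i Ω u' v')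
    (hu : MemLp u 2 (volume.restrict Ω)) (hv : MemLp v 2 (volume.restrict Ω))
    (hu' : MemLp u' 2 (volume.restrict Ω)) (hv' : MemLp v' 2 (volume.restrict Ω)) :
    IsWeakPartial i Ω (fun x => u x - u' x) (fun x => v x - v' x) := by
  have hneg : IsWeakPartial i Ω (fun x => -u' x) (fun x => -v' x) := fun φ hφ => by
    simp_rw [neg_mul, integral_neg, h' φ hφ]
  simpa only [sub_eq_add_neg] using h.add hneg hu hv hu'.neg hv'.neg

/-- Discrete integration by parts for second differences. -/
theorem integral_mul_second_difference {p g : EucSp n → ℝ} (hp : MemLp p 2 volume)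
    (hg : MemLp g 2 volume) (y : EucSp n) :
    ∫ x, p x * ((g x - g (x + y)) + (g x - g (x + -y))) =
      ∫ x, (p (x + y) - p x) * (g (x + y) - g x) := by
  have hgy := memLp_comp_add hg y
  have hgy' := memLp_comp_add hg (-y)
  have hpy := memLp_comp_add hp y
  have i1 : Integrable (fun x => p x * (g x - g (x + y))) :=
    integrable_mul_of_memLp_two hp (hg.sub hgy)
  have i2 : Integrable (fun x => p x * (g x - g (x + -y))) :=
    integrable_mul_of_memLp_two hp (hg.sub hgy')
  have i3 : Integrable (fun x => p (x + y) * (g (x + y) - g x)) :=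
    integrable_mul_of_memLp_two hpy (hgy.sub hg)
  have e1 : ∀ x, p x * ((g x - g (x + y)) + (g x - g (x + -y))) =
    p x * (g x - g (x + y)) + p x * (g x - g (x + -y)) := fun x => by ring
  have e2 : ∀ x, (p (x + y) - p x) * (g (x + y) - g x) =
    p x * (g x - g (x + y)) + p (x + y) * (g (x + y) - g x) := fun x => by ring
  simp_rw [e1, e2]
  rw [integral_add i1 i2, integral_add i1 i3,
    ← integral_add_right_eq_self (fun x => p x * (g x - g (x + -y))) y]
  simp

/-- The pointwise inequality behind the second-derivative estimate: `b` stands for the translated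
coefficients, `c` for their differences, `e` for the difference of the gradient `g`. -/
theorem nirenberg_pointwise {lam s m : ℝ} (hs : 0 < s) (hns : n * s ≤ lam / 4)
    {b c : Fin n → Fin n → ℝ} {e g : Fin n → ℝ} (hc : ∀ i j, |c i j| ≤ m)
    (hell : lam * ∑ i, e i ^ 2 ≤ ∑ i, (∑ j, b i j * e j) * e i) :
    3 * lam / 4 * ∑ i, e i ^ 2 ≤
      ∑ i, (∑ j, (b i j * e j + c i j * g j)) * e i + n * (m ^ 2 / s) * ∑ j, g j ^ 2 := by
  have hcross : ∀ i j, 0 ≤ c i j * g j * e i + s * e i ^ 2 + m ^ 2 / s * g j ^ 2 := by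
    intro i j
    have h1 : c i j ^ 2 ≤ m ^ 2 :=
      sq_le_sq' (by linarith [neg_abs_le (c i j), hc i j]) ((le_abs_self _).trans (hc i j))
    have h2 : c i j ^ 2 / s * g j ^ 2 ≤ m ^ 2 / s * g j ^ 2 := by gcongr
    have h3 : 0 ≤ (s * e i + c i j * g j / 2) ^ 2 / s := by positivity
    have h4 : (s * e i + c i j * g j / 2) ^ 2 / s =
      c i j * g j * e i + s * e i ^ 2 + c i j ^ 2 / s * g j ^ 2 / 4 := by
      field_simp; ring
    have h5 : 0 ≤ c i j ^ 2 / s * g j ^ 2 := by positivity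
    linarith
  have hsum := Finset.sum_nonneg fun i (_ : i ∈ Finset.univ) =>
    Finset.sum_nonneg fun j (_ : j ∈ Finset.univ) => hcross i j
  simp only [Finset.sum_add_distrib, Finset.sum_const, Finset.card_univ, Fintype.card_fin,
    nsmul_eq_mul, ← Finset.mul_sum] at hsum
  have hexp : ∑ i, (∑ j, (b i j * e j + c i j * g j)) * e i =
      ∑ i, (∑ j, b i j * e j) * e i + ∑ i, ∑ j, c i j * g j * e i := by
    rw [← Finset.sum_add_distrib]
    refine Finset.sum_congr rfl fun i _ => ?_
    rw [Finset.sum_add_distrib, add_mul, Finset.sum_mul, Finset.sum_mul]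
  have hS : 0 ≤ ∑ i, e i ^ 2 := Finset.sum_nonneg fun i _ => sq_nonneg _
  have hn : (n * s) * ∑ i, e i ^ 2 ≤ lam / 4 * ∑ i, e i ^ 2 := by gcongr
  rw [hexp]
  linarith

/-- **Nirenberg's estimate** for compactly supported solutions of `-div(A∇w) = f` with `f ∈ L²`
and Lipschitz coefficients: `∇w` has weak derivatives in `L²`. The constant does not depend on the
support. -/
theorem exists_nirenberg (n : ℕ) {lam : ℝ} (hlam : 0 < lam) (M : ℝ≥0) :
    ∃ C : ℝ≥0, ∀ (ρ R : ℝ) (a : Fin n → Fin n → EucSp n → ℝ) (w f : EucSp n → ℝ)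
      (g : Fin n → EucSp n → ℝ) (K : ℝ≥0), ρ < R → IsEllipticOn lam (ball 0 R) a →
      (∀ i j, AEStronglyMeasurable (a i j) (volume.restrict (ball 0 R))) →
      (∀ i j, ∀ᵐ x ∂volume.restrict (ball (0 : EucSp n) R), |a i j x| ≤ M) →
      (∀ i j, LipschitzOnWith M (a i j) (ball 0 R)) →
      MemLp w 2 volume → (∀ i, MemLp (g i) 2 volume) → (∀ i, eLpNorm (g i) 2 volume ≤ K) →
      (∀ i, IsWeakPartial i univ w (g i)) →
      (∀ x ∉ closedBall (0 : EucSp n) ρ, w x = 0) →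
      (∀ i, ∀ x ∉ closedBall (0 : EucSp n) ρ, g i x = 0) →
      MemLp f 2 (volume.restrict (ball 0 R)) → eLpNorm f 2 (volume.restrict (ball 0 R)) ≤ K →
      (∀ φ, IsTestFn (ball 0 R) φ →
        ∫ x in ball 0 R, ∑ i, (∑ j, a i j x * g j x) * partialD i φ x =
          ∫ x in ball 0 R, f x * φ x) →
      ∀ l j, ∃ G : EucSp n → ℝ, MemLp G 2 volume ∧ eLpNorm G 2 volume ≤ ↑(C * K) ∧
        IsWeakPartial l univ (g j) G := by
  -- `s` is the weight in Young's inequality for the `n²` cross terms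
  set s : ℝ := lam / (4 * (n + 1))
  have hs : 0 < s := by positivity
  have hns : n * s ≤ lam / 4 := by
    have : (n : ℝ) * s = lam / 4 * (n / (n + 1)) := by simp only [s]; field_simp
    rw [this]
    exact mul_le_of_le_one_right (by positivity) ((div_le_one (by positivity)).2 (by linarith))
  set C₀ : ℝ := 2 / lam * (1 / lam + n * (M ^ 2 / s) * n)
  have hC₀ : 0 ≤ C₀ := by positivity
  refine ⟨(Real.sqrt C₀).toNNReal, fun ρ R a w f g K hρ hell ha haM haL hw hg hgK hwg hws hgs hf
    hfK heq l j => ?_⟩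
  set p : Fin n → EucSp n → ℝ := fun i x => ∑ j, a i j x * g j x
  have hp0 : ∀ i, ∀ x ∉ closedBall (0 : EucSp n) ρ, p i x = 0 := fun i x hx =>
    Finset.sum_eq_zero fun j _ => by rw [hgs j x hx, mul_zero]
  have hcb : closedBall (0 : EucSp n) ρ ⊆ ball 0 R := closedBall_subset_ball hρ
  have hpR : ∀ i, MemLp (p i) 2 (volume.restrict (ball 0 R)) := fun i =>
    memLp_finsetSum _ fun j _ => ((hg j).restrict _).bdd_mul_two (ha i j) (haM i j)
  have hp : ∀ i, MemLp (p i) 2 volume := fun i =>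
    memLp_of_memLp_restrict measurableSet_ball (hpR i) fun x hx => hp0 i x fun h => hx (hcb h)
  have main : ∀ h, 0 < h → h < R - ρ →
      (eLpNorm (fun x => g j (x + h • coordVec l) - g j x) 2 volume).toReal ≤
        h * (Real.sqrt C₀ * K) := by
    intro h hh hhR
    set y : EucSp n := h • coordVec l
    have hy : ‖y‖ = h := by
      rw [norm_smul, norm_coordVec, mul_one, Real.norm_of_nonneg hh.le]
    have hyneg : (-h) • coordVec l = -y := neg_smul _ _
    -- `δg` is the difference of the gradient, `W` the second difference of `w`
    set δg : Fin n → EucSp n → ℝ := fun i x => g i (x + y) - g i x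
    set W : EucSp n → ℝ := fun x => (w x - w (x + y)) + (w x - w (x + -y))
    have hδg : ∀ i, MemLp (δg i) 2 volume := fun i => (memLp_comp_add (hg i) y).sub (hg i)
    have hwy := memLp_comp_add hw y
    have hwy' := memLp_comp_add hw (-y)
    have hgy := fun i => memLp_comp_add (hg i) y
    have hgy' := fun i => memLp_comp_add (hg i) (-y)
    have hW : MemLp W 2 volume := (hw.sub hwy).add (hw.sub hwy')
    have hru : ∀ {v : EucSp n → ℝ}, MemLp v 2 volume → MemLp v 2 (volume.restrict univ) :=
      fun hv => hv.restrict _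
    have hWp : ∀ i, IsWeakPartial i univ W
        (fun x => (g i x - g i (x + y)) + (g i x - g i (x + -y))) := fun i =>
      ((hwg i).sub ((hwg i).comp_add y) (hru hw) (hru (hg i)) (hru hwy) (hru (hgy i))).add
        ((hwg i).sub ((hwg i).comp_add (-y)) (hru hw) (hru (hg i)) (hru hwy') (hru (hgy' i)))
        (hru (hw.sub hwy)) (hru ((hg i).sub (hgy i))) (hru (hw.sub hwy'))
        (hru ((hg i).sub (hgy' i)))
    have hfar : ∀ {x z : EucSp n}, x ∉ closedBall (0 : EucSp n) (ρ + h) → ‖z‖ ≤ h →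
        x + z ∉ closedBall (0 : EucSp n) ρ := by
      intro x z hx hz hxz
      refine hx ?_
      simp only [mem_closedBall, dist_zero_right] at hxz ⊢
      calc ‖x‖ = ‖(x + z) - z‖ := by simp
        _ ≤ ‖x + z‖ + ‖z‖ := norm_sub_le _ _
        _ ≤ _ := by linarith
    have hfar0 : ∀ {x : EucSp n}, x ∉ closedBall (0 : EucSp n) (ρ + h) →
        x ∉ closedBall (0 : EucSp n) ρ := fun hx h' =>
      hx (closedBall_subset_closedBall (by linarith) h')
    have hWs : ∀ x ∉ closedBall (0 : EucSp n) (ρ + h), W x = 0 := fun x hx => by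
      simp only [W, hws x (hfar0 hx), hws (x + y) (hfar hx hy.le),
        hws (x + -y) (hfar hx (by rw [norm_neg, hy]))]
      ring
    -- test the equation with `W`
    have key := integral_sum_eq_of_forall_isTestFn Finset.univ (fun i _ => hpR i) hf heq
      (by linarith : ρ + h < R) hW
      (fun i _ => ((hg i).sub (hgy i)).add ((hg i).sub (hgy' i))) (fun i _ => hWp i) hWs
    rw [setIntegral_eq_integral_of_forall_compl_eq_zero (fun x hx =>
        Finset.sum_eq_zero fun i _ => by rw [hp0 i x fun h => hx (hcb h), zero_mul]),
      integral_finsetSum _ fun i _ => integrable_mul_of_memLp_two (hp i)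
        (((hg i).sub (hgy i)).add ((hg i).sub (hgy' i)))] at key
    have hsumδ : ∑ i, ∫ x, (p i (x + y) - p i x) * δg i x = ∫ x in ball 0 R, f x * W x := by
      rw [← key]
      exact Finset.sum_congr rfl fun i _ => (integral_mul_second_difference (hp i) (hg i) y).symm
    have hδp : ∀ i, MemLp (fun x => p i (x + y) - p i x) 2 volume :=
      fun i => (memLp_comp_add (hp i) y).sub (hp i)
    have iE : Integrable (fun x => ∑ i, δg i x ^ 2) volume :=
      integrable_finsetSum _ fun i _ => (hδg i).integrable_sq
    have iG : Integrable (fun x => ∑ i, g i x ^ 2) volume :=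
      integrable_finsetSum _ fun i _ => (hg i).integrable_sq
    have iP : Integrable (fun x => ∑ i, (p i (x + y) - p i x) * δg i x) volume :=
      integrable_finsetSum _ fun i _ => integrable_mul_of_memLp_two (hδp i) (hδg i)
    have hpt : ∀ x, 3 * lam / 4 * ∑ i, δg i x ^ 2 ≤
        ∑ i, (p i (x + y) - p i x) * δg i x + n * ((M * h) ^ 2 / s) * ∑ j, g j x ^ 2 := by
      intro x
      by_cases hx : x ∈ ball (0 : EucSp n) R ∧ x + y ∈ ball (0 : EucSp n) R
      · have := nirenberg_pointwise (lam := lam) (m := M * h) hs hns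
          (b := fun i j => a i j (x + y)) (c := fun i j => a i j (x + y) - a i j x)
          (e := fun i => δg i x) (g := fun j => g j x) (fun i j => by
            have := (haL i j).dist_le_mul _ hx.2 _ hx.1
            rwa [Real.dist_eq, dist_eq_norm, add_sub_cancel_left, hy] at this)
          (hell _ hx.2 _)
        convert this using 4 with i
        simp only [p, δg]
        rw [← Finset.sum_sub_distrib]
        exact Finset.sum_congr rfl fun j _ => by ring
      · -- if one of the two points leaves the ball, both are outside the support of `∇w`
        have hx0 : x ∉ closedBall (0 : EucSp n) ρ ∧ x + y ∉ closedBall (0 : EucSp n) ρ := by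
          by_cases hxR : x ∈ ball (0 : EucSp n) R
          · have hxy : x + y ∉ ball (0 : EucSp n) R := fun h => hx ⟨hxR, h⟩
            refine ⟨fun h' => hxy ?_, fun h' => hxy (hcb h')⟩
            simp only [mem_closedBall, mem_ball, dist_zero_right] at h' ⊢
            exact (norm_add_le _ _).trans_lt (by linarith)
          · have : x ∉ closedBall (0 : EucSp n) (ρ + h) := fun h' =>
              hxR (closedBall_subset_ball (by linarith) h')
            exact ⟨hfar0 this, hfar this hy.le⟩
        have h0 : ∀ i, δg i x = 0 := fun i => by simp [δg, hgs i _ hx0.1, hgs i _ hx0.2]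
        simp [h0, hgs _ _ hx0.1]
    have hint := integral_mono (iE.const_mul _) (iP.add (iG.const_mul _)) hpt
    simp only [Pi.add_apply] at hint
    rw [integral_add iP (iG.const_mul _), integral_const_mul, integral_const_mul,
      integral_finsetSum _ fun i _ => integrable_mul_of_memLp_two (hδp i) (hδg i), hsumδ,
      integral_finsetSum _ fun i _ => (hδg i).integrable_sq,
      integral_finsetSum _ fun i _ => (hg i).integrable_sq] at hint
    set X : ℝ := ∑ i, ∫ x, δg i x ^ 2
    have hXi : ∀ i, (eLpNorm (δg i) 2 volume).toReal ^ 2 ≤ X := fun i => by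
      rw [toReal_eLpNorm_two_sq (hδg i)]
      exact Finset.single_le_sum (f := fun i => ∫ x, δg i x ^ 2)
        (fun _ _ => integral_nonneg fun _ => sq_nonneg _) (Finset.mem_univ i)
    have hgsum : ∑ i, ∫ x, g i x ^ 2 ≤ n * (K : ℝ) ^ 2 := by
      calc _ ≤ ∑ _i : Fin n, (K : ℝ) ^ 2 := Finset.sum_le_sum fun i _ => by
            rw [← toReal_eLpNorm_two_sq (hg i)]
            gcongr
            exact ENNReal.toReal_le_coe_of_le_coe (hgK i)
        _ = _ := by simp
    -- the second difference of `w` is a difference of `w(· + y) - w`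
    have hWl : (eLpNorm W 2 volume).toReal ≤ h * (eLpNorm (δg l) 2 volume).toReal := by
      have h1 := eLpNorm_translate_sub_le (w := fun x => w (x + y) - w x) (g := δg l) (l := l)
        (ρ := ρ + h) (hwy.sub hw) (hδg l)
        (((hwg l).comp_add y).sub (hwg l) (hru hwy) (hru (hgy l)) (hru hw) (hru (hg l)))
        (fun x hx => by simp [hws x (hfar0 hx), hws (x + y) (hfar hx hy.le)]) (-h)
      rw [hyneg] at h1
      have e : (fun x => w (x + -y + y) - w (x + -y) - (w (x + y) - w x)) = W := by
        ext x; simp only [W, neg_add_cancel_right]; ring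
      rw [e] at h1
      have := ENNReal.toReal_mono (ENNReal.mul_ne_top enorm_ne_top (hδg l).2.ne) h1
      simpa [abs_of_pos hh] using this
    have hfW : |∫ x in ball 0 R, f x * W x| ≤ K * (h * (eLpNorm (δg l) 2 volume).toReal) := by
      refine (abs_integral_mul_le hf (hW.restrict _)).trans ?_
      refine mul_le_mul (ENNReal.toReal_le_coe_of_le_coe hfK) (le_trans ?_ hWl)
        ENNReal.toReal_nonneg K.2
      exact ENNReal.toReal_mono hW.2.ne (eLpNorm_mono_measure _ Measure.restrict_le_self)
    have hyoung : K * (h * (eLpNorm (δg l) 2 volume).toReal) ≤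
        lam / 4 * X + h ^ 2 * K ^ 2 / lam := by
      set z := (eLpNorm (δg l) 2 volume).toReal
      have h1 : 0 ≤ (lam / 2 * z - K * h) ^ 2 / lam := by positivity
      have h2 : (lam / 2 * z - K * h) ^ 2 / lam =
        lam / 4 * z ^ 2 - K * (h * z) + h ^ 2 * K ^ 2 / lam := by field_simp; ring
      have h3 : lam / 4 * z ^ 2 ≤ lam / 4 * X := by gcongr; exact hXi l
      linarith
    have hX : X ≤ h ^ 2 * (C₀ * K ^ 2) := by
      have h1 : n * ((M * h) ^ 2 / s) * ∑ i, ∫ x, g i x ^ 2 ≤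
          n * ((M * h) ^ 2 / s) * (n * (K : ℝ) ^ 2) := by gcongr
      have h2 : lam / 2 * X ≤ h ^ 2 * K ^ 2 / lam + n * ((M * h) ^ 2 / s) * (n * (K : ℝ) ^ 2) := by
        linarith [(abs_le.1 hfW).2]
      have h3 : X = 2 / lam * (lam / 2 * X) := by field_simp
      have h4 : h ^ 2 * (C₀ * K ^ 2) = 2 / lam *
          (h ^ 2 * K ^ 2 / lam + n * ((M * h) ^ 2 / s) * (n * (K : ℝ) ^ 2)) := by
        simp only [C₀]; ring
      rw [h3, h4]
      gcongr
    refine abs_le_of_sq_le_sq' ?_ (by positivity) |>.2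
    calc _ ≤ X := hXi j
      _ ≤ h ^ 2 * (C₀ * K ^ 2) := hX
      _ = _ := by rw [mul_pow, mul_pow, Real.sq_sqrt hC₀]
  obtain ⟨G, hG, hGK, hGw⟩ := exists_isWeakPartial_of_translate_bound (sub_pos.2 hρ) (hg j)
    (hgs j) main
  refine ⟨G, hG, ?_, hGw⟩
  rw [← ENNReal.ofReal_toReal hG.2.ne, ← ENNReal.ofReal_coe_nnreal]
  refine ENNReal.ofReal_le_ofReal (hGK.trans ?_)
  rw [NNReal.coe_mul, Real.coe_toNNReal _ (Real.sqrt_nonneg _)]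

/-! ### Quantitative Sobolev regularity -/

/-- `u ∈ H^k(Ω)`, and `u` and its weak partial derivatives up to order `k` have `L²(Ω)` norm at most
`K`; by recursion on `k`. -/
def HkBound : ℕ → Set (EucSp n) → (EucSp n → ℝ) → ℝ≥0 → Prop
  | 0, Ω, u, K => MemLp u 2 (volume.restrict Ω) ∧ eLpNorm u 2 (volume.restrict Ω) ≤ K
  | k + 1, Ω, u, K => (MemLp u 2 (volume.restrict Ω) ∧ eLpNorm u 2 (volume.restrict Ω) ≤ K) ∧
      ∀ i, ∃ v, IsWeakPartial i Ω u v ∧ HkBound k Ω v K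

/-- `a ∈ W^{k,∞}(Ω)`, and `a` and its weak partial derivatives up to order `k` are bounded by `M`
almost everywhere; by recursion on `k`. -/
def WkInfBound : ℕ → Set (EucSp n) → (EucSp n → ℝ) → ℝ≥0 → Prop
  | 0, Ω, a, M => AEStronglyMeasurable a (volume.restrict Ω) ∧
      ∀ᵐ x ∂volume.restrict Ω, |a x| ≤ M
  | k + 1, Ω, a, M => (AEStronglyMeasurable a (volume.restrict Ω) ∧
      ∀ᵐ x ∂volume.restrict Ω, |a x| ≤ M) ∧ ∀ i, ∃ b, IsWeakPartial i Ω a b ∧ WkInfBound k Ω b M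

namespace WkInfBound

variable {k : ℕ} {Ω Ω' : Set (EucSp n)} {a : EucSp n → ℝ} {M : ℝ≥0}

theorem bdd (h : WkInfBound k Ω a M) : WkInfBound 0 Ω a M := by
  cases k with
  | zero => exact h
  | succ k => exact h.1

theorem of_succ (h : WkInfBound (k + 1) Ω a M) : WkInfBound k Ω a M := by
  induction k generalizing a with
  | zero => exact h.1
  | succ k ih => exact ⟨h.1, fun i => (h.2 i).imp fun _ hb => ⟨hb.1, ih hb.2⟩⟩

theorem mono_set (h : WkInfBound k Ω a M) (hΩ : Ω' ⊆ Ω) : WkInfBound k Ω' a M := by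
  have hb := h.bdd
  have hb' : WkInfBound 0 Ω' a M :=
    ⟨hb.1.mono_measure (Measure.restrict_mono hΩ le_rfl),
      ae_restrict_of_ae_restrict_of_subset hΩ hb.2⟩
  induction k generalizing a with
  | zero => exact hb'
  | succ k ih =>
    refine ⟨hb', fun i => ?_⟩
    obtain ⟨b, hab, hbk⟩ := h.2 i
    refine ⟨b, hab.mono hΩ, ih hbk hbk.bdd ⟨?_, ?_⟩⟩
    · exact hbk.bdd.1.mono_measure (Measure.restrict_mono hΩ le_rfl)
    · exact ae_restrict_of_ae_restrict_of_subset hΩ hbk.bdd.2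

end WkInfBound

namespace HkBound

variable {k : ℕ} {Ω Ω' : Set (EucSp n)} {u v : EucSp n → ℝ} {K K' : ℝ≥0}

theorem l2 (h : HkBound k Ω u K) : HkBound 0 Ω u K := by
  cases k with
  | zero => exact h
  | succ k => exact h.1

theorem of_succ (h : HkBound (k + 1) Ω u K) : HkBound k Ω u K := by
  induction k generalizing u with
  | zero => exact h.1
  | succ k ih => exact ⟨h.1, fun i => (h.2 i).imp fun _ hb => ⟨hb.1, ih hb.2⟩⟩

theorem mono (h : HkBound k Ω u K) (hK : K ≤ K') : HkBound k Ω u K' := by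
  induction k generalizing u with
  | zero => exact ⟨h.1, h.2.trans (by exact_mod_cast hK)⟩
  | succ k ih => exact ⟨⟨h.1.1, h.1.2.trans (by exact_mod_cast hK)⟩,
      fun i => (h.2 i).imp fun _ hb => ⟨hb.1, ih hb.2⟩⟩

theorem mono_set (h : HkBound k Ω u K) (hΩ : Ω' ⊆ Ω) : HkBound k Ω' u K := by
  have h0 : ∀ {v : EucSp n → ℝ}, HkBound 0 Ω v K → HkBound 0 Ω' v K := fun hv =>
    ⟨hv.1.mono_measure (Measure.restrict_mono hΩ le_rfl),
      (eLpNorm_mono_measure _ (Measure.restrict_mono hΩ le_rfl)).trans hv.2⟩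
  induction k generalizing u with
  | zero => exact h0 h
  | succ k ih => exact ⟨h0 h.1, fun i => (h.2 i).imp fun _ hb => ⟨hb.1.mono hΩ, ih hb.2⟩⟩

theorem add (hu : HkBound k Ω u K) (hv : HkBound k Ω v K') :
    HkBound k Ω (fun x => u x + v x) (K + K') := by
  have h0 : ∀ {u v : EucSp n → ℝ}, HkBound 0 Ω u K → HkBound 0 Ω v K' →
      HkBound 0 Ω (fun x => u x + v x) (K + K') := fun hu hv => ⟨hu.1.add hv.1, by
    rw [ENNReal.coe_add]
    exact (eLpNorm_add_le hu.1.1 hv.1.1 (by norm_num)).trans (add_le_add hu.2 hv.2)⟩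
  induction k generalizing u v with
  | zero => exact h0 hu hv
  | succ k ih =>
    refine ⟨h0 hu.1 hv.1, fun i => ?_⟩
    obtain ⟨u', huu', hu'⟩ := hu.2 i
    obtain ⟨v', hvv', hv'⟩ := hv.2 i
    exact ⟨_, huu'.add hvv' hu.1.1 hu'.l2.1 hv.1.1 hv'.l2.1, ih hu' hv'⟩

theorem zero (k : ℕ) (Ω : Set (EucSp n)) : HkBound k Ω (fun _ => 0) 0 := by
  have h0 : HkBound 0 Ω (fun _ => 0) 0 := ⟨MemLp.zero', by simp⟩
  induction k with
  | zero => exact h0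
  | succ k ih => exact ⟨h0, fun i => ⟨_, fun φ _ => by simp, ih⟩⟩

theorem sum {ι : Type*} (s : Finset ι) {u : ι → EucSp n → ℝ} {K : ι → ℝ≥0}
    (h : ∀ j ∈ s, HkBound k Ω (u j) (K j)) :
    HkBound k Ω (fun x => ∑ j ∈ s, u j x) (∑ j ∈ s, K j) := by
  classical
  induction s using Finset.induction_on with
  | empty => simpa using zero k Ω
  | insert a s ha ih =>
    simp_rw [Finset.sum_insert ha]
    simp only [Finset.mem_insert, forall_eq_or_imp] at h
    exact h.1.add (ih h.2)

theorem bdd_mul_zero {a : EucSp n → ℝ} {M : ℝ≥0} (ha : WkInfBound 0 Ω a M) (hu : HkBound 0 Ω u K) :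
    HkBound 0 Ω (fun x => a x * u x) (M * K) :=
  ⟨hu.1.bdd_mul_two ha.1 ha.2, (eLpNorm_bdd_mul_le ha.2 2).trans (by
    rw [ENNReal.coe_mul]; gcongr; exact hu.2)⟩

/-- Multiplication by a `W^{k,∞}` function maps `H^k` to itself. -/
theorem wkInf_mul {R : ℝ} {a : EucSp n → ℝ} {M : ℝ≥0} (ha : WkInfBound k (ball 0 R) a M)
    (hu : HkBound k (ball 0 R) u K) :
    HkBound k (ball 0 R) (fun x => a x * u x) (2 ^ k * (M * K)) := by
  induction k generalizing a u with
  | zero => simpa using bdd_mul_zero ha hu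
  | succ k ih =>
    refine ⟨(bdd_mul_zero ha.1 hu.1 : HkBound 0 _ _ _).mono ?_, fun i => ?_⟩
    · exact le_mul_of_one_le_left zero_le (one_le_pow₀ one_le_two)
    · obtain ⟨b, hab, hb⟩ := ha.2 i
      obtain ⟨v, huv, hv⟩ := hu.2 i
      refine ⟨_, hab.bdd_mul huv ha.1.1 ha.1.2 hb.bdd.1 hb.bdd.2 hu.1.1 hv.l2.1, ?_⟩
      refine ((ih hb hu.of_succ).add (ih ha.of_succ hv)).mono (le_of_eq ?_)
      ring

end HkBound

theorem IsTestFn.wkInfBound_zero {Ω Ω' : Set (EucSp n)} {φ : EucSp n → ℝ} (h : IsTestFn Ω φ) :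
    ∃ D : ℝ≥0, WkInfBound 0 Ω' φ D := by
  obtain ⟨D, hD⟩ := h.exists_bound
  exact ⟨D, h.continuous.aestronglyMeasurable, .of_forall hD⟩

/-- The hypotheses on the coefficients: ellipticity, a Lipschitz bound, and a `W^{k,∞}` bound. -/
structure IsRegularCoeff (lam : ℝ) (M : ℝ≥0) (k : ℕ) (Ω : Set (EucSp n))
    (a : Fin n → Fin n → EucSp n → ℝ) : Prop where
  elliptic : IsEllipticOn lam Ω a
  lipschitz : ∀ i j, LipschitzOnWith M (a i j) Ω
  bound : ∀ i j, WkInfBound k Ω (a i j) M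

theorem IsRegularCoeff.mono_set {lam : ℝ} {M : ℝ≥0} {k : ℕ} {Ω Ω' : Set (EucSp n)}
    {a : Fin n → Fin n → EucSp n → ℝ} (h : IsRegularCoeff lam M k Ω a) (hΩ : Ω' ⊆ Ω) :
    IsRegularCoeff lam M k Ω' a :=
  ⟨fun x hx => h.elliptic x (hΩ hx), fun i j => (h.lipschitz i j).mono hΩ,
    fun i j => (h.bound i j).mono_set hΩ⟩

theorem IsRegularCoeff.of_succ {lam : ℝ} {M : ℝ≥0} {k : ℕ} {Ω : Set (EucSp n)}
    {a : Fin n → Fin n → EucSp n → ℝ} (h : IsRegularCoeff lam M (k + 1) Ω a) :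
    IsRegularCoeff lam M k Ω a :=
  ⟨h.elliptic, h.lipschitz, fun i j => (h.bound i j).of_succ⟩

theorem IsWeakDivFree.mono {Ω Ω' : Set (EucSp n)} {H : Fin n → EucSp n → ℝ}
    (h : IsWeakDivFree Ω H) (hΩ : Ω' ⊆ Ω) : IsWeakDivFree Ω' H := by
  intro φ hφ
  rw [← h φ (hφ.mono hΩ), setIntegral_eq_integral_of_forall_compl_eq_zero,
    setIntegral_eq_integral_of_forall_compl_eq_zero]
  · intro x hx
    exact Finset.sum_eq_zero fun i _ => by
      rw [(hφ.partialD i).eq_zero fun h => hx (hΩ h), mul_zero]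
  · intro x hx
    exact Finset.sum_eq_zero fun i _ => by rw [(hφ.partialD i).eq_zero hx, mul_zero]

theorem HkBound.neg_zero {Ω : Set (EucSp n)} {u : EucSp n → ℝ} {K : ℝ≥0} (h : HkBound 0 Ω u K) :
    HkBound 0 Ω (fun x => -u x) K :=
  ⟨h.1.neg, (eLpNorm_neg u 2 _).trans_le h.2⟩

/-- The `H²` estimate: if the gradient of a weak solution of `div(A∇u + F) = 0` is in `L²` and
`F ∈ H¹`, then the gradient is in `H¹` of a smaller ball. A cut-off of `u` solves an equation with
right-hand side in `L²`, to which Nirenberg's estimate applies. -/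
theorem exists_second_order (n : ℕ) {lam : ℝ} (hlam : 0 < lam) (M : ℝ≥0) {r R : ℝ} (hr : 0 < r)
    (hrR : r < R) :
    ∃ C : ℝ≥0, ∀ (a : Fin n → Fin n → EucSp n → ℝ) (u : EucSp n → ℝ) (g f : Fin n → EucSp n → ℝ)
      (K : ℝ≥0), IsRegularCoeff lam M 1 (ball 0 R) a → HkBound 0 (ball 0 R) u K →
      (∀ i, HkBound 0 (ball 0 R) (g i) K) → (∀ i, IsWeakPartial i (ball 0 R) u (g i)) →
      (∀ i, HkBound 1 (ball 0 R) (f i) K) → IsWeakDivFree (ball 0 R) (flux a g f) →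
      ∀ i, HkBound 1 (ball 0 r) (g i) (C * K) := by
  obtain ⟨C, hC⟩ := exists_nirenberg n hlam M
  obtain ⟨η, hη, hη1, -⟩ := exists_cutoff (n := n) hr hrR
  obtain ⟨D₀, hD₀⟩ := hη.wkInfBound_zero (Ω' := ball 0 R)
  choose D₁ hD₁ using fun i => (hη.partialD i).wkInfBound_zero (Ω' := ball 0 R)
  choose D₂ hD₂ using fun i j => ((hη.partialD j).partialD i).wkInfBound_zero (Ω' := ball 0 R)
  set B : ℝ≥0 := (∑ i, (D₀ + D₁ i * (∑ _j : Fin n, M) +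
    ∑ j, (D₁ j * (M + M) + D₂ i j * M))) + (D₀ + ∑ j, D₁ j)
  refine ⟨C * B + 1, fun a u g f K ha hu hg hug hf hdiv => ?_⟩
  choose b hab hb using fun i j => (ha.bound i j).2 i
  choose df hfdf hdf using fun i => (hf i).2 i
  have ha0 : ∀ i j, WkInfBound 0 (ball 0 R) (a i j) M := fun i j => (ha.bound i j).1
  -- the cut-off solution `ηu` has gradient `gw`
  set gw : Fin n → EucSp n → ℝ := fun j x => η x * g j x + partialD j η x * u x
  have hgw : ∀ j, MemLp (gw j) 2 volume := fun j =>
    hη.mul_add_memLp measurableSet_ball hu.1 (hg j).1 j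
  have hgw0 : ∀ j, ∀ x ∉ ball (0 : EucSp n) R, gw j x = 0 := fun j x hx => by
    simp [gw, hη.eq_zero hx, (hη.partialD j).eq_zero hx]
  have hgwB : ∀ j, eLpNorm (gw j) 2 volume ≤ ↑(B * K) := fun j => by
    rw [eLpNorm_eq_restrict measurableSet_ball (hgw0 j)]
    have h1 : HkBound 0 (ball 0 R) (gw j) (D₀ * K + D₁ j * K) :=
      (HkBound.bdd_mul_zero hD₀ (hg j)).add (HkBound.bdd_mul_zero (hD₁ j) hu)
    refine (h1.mono ?_).2
    rw [← add_mul]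
    gcongr
    refine le_trans ?_ le_add_self
    gcongr
    exact Finset.single_le_sum (f := D₁) (fun _ _ => zero_le) (Finset.mem_univ j)
  -- `q i j` is the `i`-th weak derivative of `∂ⱼη aᵢⱼ u`
  set q : Fin n → Fin n → EucSp n → ℝ := fun i j x =>
    partialD j η x * (b i j x * u x + a i j x * g i x) +
      partialD i (partialD j η) x * (a i j x * u x)
  have hau : ∀ i j, HkBound 0 (ball 0 R) (fun x => a i j x * u x) (M * K) := fun i j =>
    HkBound.bdd_mul_zero (ha0 i j) hu
  have hag : ∀ i j, HkBound 0 (ball 0 R) (fun x => b i j x * u x + a i j x * g i x)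
      (M * K + M * K) := fun i j =>
    (HkBound.bdd_mul_zero (hb i j) hu).add (HkBound.bdd_mul_zero (ha0 i j) (hg i))
  have hq : ∀ i j, HkBound 0 (ball 0 R) (q i j)
      (D₁ j * (M * K + M * K) + D₂ i j * (M * K)) := fun i j =>
    (HkBound.bdd_mul_zero (hD₁ j) (hag i j)).add (HkBound.bdd_mul_zero (hD₂ i j) (hau i j))
  have hqw : ∀ i j, IsWeakPartial i (ball 0 R) (fun x => partialD j η x * (a i j x * u x))
      (q i j) := fun i j =>
    ((hab i j).bdd_mul (hug i) (ha0 i j).1 (ha0 i j).2 (hb i j).1 (hb i j).2 hu.1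
      (hg i).1).smooth_mul (hau i j).1 (hag i j).1 (hη.partialD j).1
  set p : Fin n → EucSp n → ℝ := fun i x => ∑ j, a i j x * g j x
  have hp : ∀ i, HkBound 0 (ball 0 R) (p i) (∑ _j : Fin n, M * K) := fun i =>
    HkBound.sum _ fun j _ => HkBound.bdd_mul_zero (ha0 i j) (hg j)
  set F : Fin n → EucSp n → ℝ := fun i x =>
    η x * df i x + -(partialD i η x * p i x) + -∑ j, q i j x
  have hF : ∀ i, HkBound 0 (ball 0 R) (F i) (D₀ * K + D₁ i * (∑ _j : Fin n, M * K) +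
      ∑ j, (D₁ j * (M * K + M * K) + D₂ i j * (M * K))) := fun i =>
    ((HkBound.bdd_mul_zero hD₀ (hdf i)).add
      (HkBound.bdd_mul_zero (hD₁ i) (hp i)).neg_zero).add
      (HkBound.sum _ fun j _ => hq i j).neg_zero
  have hFsum : HkBound 0 (ball 0 R) (fun x => ∑ i, F i x) (B * K) := by
    refine (HkBound.sum Finset.univ fun i _ => hF i).mono ?_
    rw [add_mul]
    refine le_trans (le_of_eq ?_) le_self_add
    simp only [Finset.sum_mul, Finset.mul_sum, add_mul, mul_add, mul_assoc, Finset.sum_add_distrib]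
  have heq : ∀ φ, IsTestFn (ball 0 R) φ →
      ∫ x in ball 0 R, ∑ i, (∑ j, a i j x * gw j x) * partialD i φ x =
        ∫ x in ball 0 R, (∑ i, F i x) * φ x := by
    intro φ hφ
    have hηφ : IsTestFn (ball 0 R) fun x => η x * φ x := hφ.mul_left hη.1
    have hφ2 := hφ.memLp 2 (volume.restrict (ball 0 R))
    have hdφ2 := fun i => (hφ.partialD i).memLp 2 (volume.restrict (ball 0 R))
    have hηφ2 := hηφ.memLp 2 (volume.restrict (ball 0 R))
    have hdηφ2 := fun i => (hηφ.partialD i).memLp 2 (volume.restrict (ball 0 R))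
    have hflux := flux_memLp (fun i j => (ha0 i j).1) (fun i j => (ha0 i j).2)
      (fun i => (hg i).1) (fun i => (hf i).l2.1)
    have hstep : ∀ i, ∫ x in ball 0 R, (∑ j, a i j x * gw j x) * partialD i φ x =
        (∫ x in ball 0 R, flux a g f i x * partialD i (fun x => η x * φ x) x) +
          ∫ x in ball 0 R, F i x * φ x := by
      intro i
      have i1 := integrable_mul_of_memLp_two (hflux i) (hdηφ2 i)
      have i2 := integrable_mul_of_memLp_two (hf i).l2.1 (hdηφ2 i)
      have i3 := integrable_mul_of_memLp_two (HkBound.bdd_mul_zero (hD₁ i) (hp i)).1 hφ2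
      have hq' : ∀ j, MemLp (fun x => partialD j η x * (a i j x * u x)) 2
          (volume.restrict (ball 0 R)) := fun j => (HkBound.bdd_mul_zero (hD₁ j) (hau i j)).1
      have i4 := fun j => integrable_mul_of_memLp_two (hq' j) (hdφ2 i)
      have i5 := fun j => integrable_mul_of_memLp_two (hq i j).1 hφ2
      have i6 := integrable_mul_of_memLp_two (HkBound.bdd_mul_zero hD₀ (hdf i)).1 hφ2
      have i4s : Integrable (fun x => ∑ j, partialD j η x * (a i j x * u x) * partialD i φ x)
        (volume.restrict (ball 0 R)) := integrable_finsetSum _ fun j _ => i4 j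
      have i5s : Integrable (fun x => ∑ j, q i j x * φ x)
        (volume.restrict (ball 0 R)) := integrable_finsetSum _ fun j _ => i5 j
      have e1 : ∀ x, (∑ j, a i j x * gw j x) * partialD i φ x =
          flux a g f i x * partialD i (fun x => η x * φ x) x -
            f i x * partialD i (fun x => η x * φ x) x - partialD i η x * p i x * φ x +
            ∑ j, partialD j η x * (a i j x * u x) * partialD i φ x := by
        intro x
        rw [partialD_mul i (hη.differentiable x) (hφ.differentiable x)]
        have h1 : ∑ j, a i j x * gw j x =
            η x * p i x + ∑ j, partialD j η x * (a i j x * u x) := by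
          simp only [p, gw]
          rw [Finset.mul_sum, ← Finset.sum_add_distrib]
          exact Finset.sum_congr rfl fun j _ => by ring
        rw [h1, ← Finset.sum_mul]
        simp only [flux, p]
        ring
      have e2 : ∀ x, F i x * φ x = η x * df i x * φ x - partialD i η x * p i x * φ x -
          ∑ j, q i j x * φ x := by
        intro x
        rw [← Finset.sum_mul]
        simp only [F]
        ring
      simp_rw [e1, e2]
      have i12 : Integrable (fun x => flux a g f i x * partialD i (fun x => η x * φ x) x -
        f i x * partialD i (fun x => η x * φ x) x) (volume.restrict (ball 0 R)) := i1.sub i2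
      have i123 : Integrable (fun x => flux a g f i x * partialD i (fun x => η x * φ x) x -
        f i x * partialD i (fun x => η x * φ x) x - partialD i η x * p i x * φ x)
        (volume.restrict (ball 0 R)) := i12.sub i3
      have i63 : Integrable (fun x => η x * df i x * φ x - partialD i η x * p i x * φ x)
        (volume.restrict (ball 0 R)) := i6.sub i3
      rw [integral_add i123 i4s, integral_sub i12 i3, integral_sub i1 i2,
        integral_sub i63 i5s, integral_sub i6 i3, integral_finsetSum _ fun j _ => i4 j,
        integral_finsetSum _ fun j _ => i5 j, hfdf i _ hηφ,
        Finset.sum_congr rfl fun j _ => hqw i j φ hφ, Finset.sum_neg_distrib]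
      have e3 : ∀ x, df i x * (η x * φ x) = η x * df i x * φ x := fun x => by ring
      simp_rw [e3]
      ring
    have hgwa : ∀ i, MemLp (fun x => ∑ j, a i j x * gw j x) 2 (volume.restrict (ball 0 R)) :=
      fun i => memLp_finsetSum _ fun j _ =>
        ((hgw j).restrict _).bdd_mul_two (ha0 i j).1 (ha0 i j).2
    have h0 := hdiv _ hηφ
    rw [integral_finsetSum _ fun i _ => integrable_mul_of_memLp_two (hflux i) (hdηφ2 i)] at h0
    have hsum : ∀ x, (∑ i, F i x) * φ x = ∑ i, F i x * φ x := fun x => Finset.sum_mul _ _ _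
    simp_rw [hsum]
    rw [integral_finsetSum _ fun i _ => integrable_mul_of_memLp_two (hgwa i) (hdφ2 i),
      integral_finsetSum _ fun i _ => integrable_mul_of_memLp_two (hF i).1 hφ2,
      Finset.sum_congr rfl fun i _ => hstep i, Finset.sum_add_distrib, h0, zero_add]
  obtain ⟨ρ, hρ, hηρ⟩ := exists_lt_subset_ball (isClosed_tsupport η) hη.2.2
  have hη0 : ∀ x ∉ closedBall (0 : EucSp n) ρ, x ∉ tsupport η := fun x hx h =>
    hx (ball_subset_closedBall (hηρ h))
  intro j
  have hsub : ball (0 : EucSp n) r ⊆ ball 0 R := ball_subset_ball hrR.le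
  refine ⟨((hg j).mono_set hsub).mono (K' := (C * B + 1) * K) ?_, fun l => ?_⟩
  · exact le_mul_of_one_le_left zero_le le_add_self
  obtain ⟨G, hG, hGK, hGw⟩ := hC ρ R a (fun x => η x * u x) (fun x => ∑ i, F i x) gw (B * K) hρ
    ha.elliptic (fun i j => (ha0 i j).1) (fun i j => (ha0 i j).2) ha.lipschitz
    (hη.mul_memLp measurableSet_ball hu.1) hgw hgwB
    (fun i => (hug i).test_mul hu.1 (hg i).1 hη)
    (fun x hx => by rw [image_eq_zero_of_notMem_tsupport (hη0 x hx), zero_mul])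
    (fun i x hx => by
      simp only [gw, image_eq_zero_of_notMem_tsupport (hη0 x hx), image_eq_zero_of_notMem_tsupport
        fun h => hη0 x hx (tsupport_partialD_subset i η h)]
      ring) hFsum.1 hFsum.2 heq l j
  refine ⟨G, (hGw.mono (subset_univ _)).congr ?_ .rfl, hG.restrict _,
    (eLpNorm_mono_measure _ Measure.restrict_le_self).trans (hGK.trans ?_)⟩
  · filter_upwards [ae_restrict_mem measurableSet_ball] with x hx
    have hev : η =ᶠ[𝓝 x] fun _ => 1 :=
      (isOpen_ball.eventually_mem hx).mono fun y hy => hη1 y hy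
    have : partialD j η x = 0 := by
      unfold partialD
      rw [hev.fderiv_eq]; simp
    simp [gw, hη1 x hx, this]
  · rw [← mul_assoc]
    exact_mod_cast mul_le_mul_of_nonneg_right (le_self_add) zero_le

/-- The gradient of a weak solution of `div(A∇u + F) = 0` satisfies `‖∇u‖_{H^m(B_r)} ≤ CK` when
`‖u‖_{L²(B_R)} ≤ K` and `‖F‖_{H^m(B_R)} ≤ K`. The inductive step applies the estimate to `∂ₗu`,
which solves the equation with `∂ₗF + (∂ₗA)∇u` in place of `F`. -/
theorem exists_higher_order (n : ℕ) {lam : ℝ} (hlam : 0 < lam) (M : ℝ≥0) (m : ℕ) {r R : ℝ}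
    (hr : 0 < r) (hrR : r < R) :
    ∃ C : ℝ≥0, ∀ (a : Fin n → Fin n → EucSp n → ℝ) (u : EucSp n → ℝ) (g f : Fin n → EucSp n → ℝ)
      (K : ℝ≥0), IsRegularCoeff lam M m (ball 0 R) a → HkBound 0 (ball 0 R) u K →
      (∀ i, MemLp (g i) 2 (volume.restrict (ball 0 R))) →
      (∀ i, IsWeakPartial i (ball 0 R) u (g i)) →
      (∀ i, HkBound m (ball 0 R) (f i) K) → IsWeakDivFree (ball 0 R) (flux a g f) →
      ∀ i, HkBound m (ball 0 r) (g i) (C * K) := by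
  induction m generalizing r R with
  | zero =>
    obtain ⟨C, hC⟩ := exists_caccioppoli n hlam M hr hrR
    refine ⟨C, fun a u g f K ha hu hg hug hf hdiv i => ⟨(hg i).mono_measure
      (Measure.restrict_mono (ball_subset_ball hrR.le) le_rfl), ?_⟩⟩
    exact hC a u g f K ha.elliptic (fun i j => (ha.bound i j).1) (fun i j => (ha.bound i j).2)
      hu.1 hu.2 hg hug (fun i => (hf i).1) (fun i => (hf i).2) hdiv i
  | succ m ih =>
    obtain ⟨r', hr', hr'R⟩ := exists_between hrR
    have hr'0 : 0 < r' := hr.trans hr'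
    have hsub : ball (0 : EucSp n) r' ⊆ ball 0 R := ball_subset_ball hr'R.le
    obtain ⟨C₁, hC₁⟩ := ih hr'0 hr'R
    cases m with
    | zero =>
      obtain ⟨C₂, hC₂⟩ := exists_second_order n hlam M hr hr'
      refine ⟨C₂ * (C₁ + 1), fun a u g f K ha hu hg hug hf hdiv i => ?_⟩
      have hK : K ≤ (C₁ + 1) * K := le_mul_of_one_le_left zero_le le_add_self
      have h1 := hC₁ a u g f K ha.of_succ hu hg hug (fun i => (hf i).of_succ) hdiv
      rw [mul_assoc]
      refine hC₂ a u g f _ (ha.mono_set hsub) ((hu.mono_set hsub).mono hK)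
        (fun i => (h1 i).mono ?_) (fun i => (hug i).mono hsub)
        (fun i => ((hf i).mono_set hsub).mono hK) (hdiv.mono hsub) i
      gcongr
      exact le_self_add
    | succ m =>
      obtain ⟨C₂, hC₂⟩ := ih hr hr'
      set B : ℝ≥0 := (∑ _j : Fin n, 2 ^ (m + 1) * (M * C₁)) + 1 + C₁
      refine ⟨C₂ * B + C₁, fun a u g f K ha hu hg hug hf hdiv j => ?_⟩
      have h1 := hC₁ a u g f K ha.of_succ hu hg hug (fun i => (hf i).of_succ) hdiv
      have hadd : C₁ * K ≤ (C₂ * B + C₁) * K := by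
        gcongr; exact le_add_self
      refine ⟨((h1 j).l2.mono_set (ball_subset_ball hr'.le)).mono hadd,
        fun l => ?_⟩
      -- `D j` is the weak derivative `∂ₗ∂ⱼu`, and `b i j` and `df i` are those of `aᵢⱼ` and `fᵢ`
      choose D hD hDk using fun j => (h1 j).2 l
      choose b hab hb using fun i j => (ha.bound i j).2 l
      choose df hfdf hdf using fun i => (hf i).2 l
      refine ⟨D j, (hD j).mono (ball_subset_ball hr'.le), ?_⟩
      set F : Fin n → EucSp n → ℝ := fun i x => ∑ j, b i j x * g j x + df i x
      have hF : ∀ i, HkBound (m + 1) (ball 0 r') (F i) (B * K) := fun i => by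
        refine ((HkBound.sum Finset.univ fun j _ =>
          HkBound.wkInf_mul ((hb i j).mono_set hsub) (h1 j)).add ((hdf i).mono_set hsub)).mono ?_
        simp only [B, add_mul, Finset.sum_mul, one_mul, mul_assoc]
        exact le_self_add
      have hg' : ∀ j, MemLp (g j) 2 (volume.restrict (ball 0 r')) := fun j => (h1 j).l2.1
      have hDw : ∀ i, IsWeakPartial i (ball 0 r') (g l) (D i) := by
        intro i φ hφ
        have hu' := (hu.mono_set hsub).1
        have e1 := (hug l).mono hsub _ (hφ.partialD i)
        have e2 := (hug i).mono hsub _ (hφ.partialD l)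
        rw [partialD_comm l i hφ.1] at e1
        rw [← neg_inj, ← e1, e2, neg_inj]
        exact hD i φ hφ
      have hdiv' : IsWeakDivFree (ball 0 r') (flux a D F) := by
        intro φ hφ
        have ha0 : ∀ i j, WkInfBound 0 (ball 0 r') (a i j) M := fun i j =>
          ((ha.bound i j).mono_set hsub).bdd
        have hb0 : ∀ i j, WkInfBound 0 (ball 0 r') (b i j) M := fun i j =>
          ((hb i j).mono_set hsub).bdd
        have hf' : ∀ i, MemLp (f i) 2 (volume.restrict (ball 0 r')) :=
          fun i => ((hf i).mono_set hsub).l2.1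
        have hdf' : ∀ i, MemLp (df i) 2 (volume.restrict (ball 0 r')) :=
          fun i => ((hdf i).mono_set hsub).l2.1
        have hD' : ∀ i, MemLp (D i) 2 (volume.restrict (ball 0 r')) := fun i => (hDk i).l2.1
        have m1 : ∀ i j, MemLp (fun x => a i j x * g j x) 2 (volume.restrict (ball 0 r')) :=
          fun i j => (hg' j).bdd_mul_two (ha0 i j).1 (ha0 i j).2
        have m2 : ∀ i j, MemLp (fun x => b i j x * g j x + a i j x * D j x) 2
            (volume.restrict (ball 0 r')) := fun i j =>
          ((hg' j).bdd_mul_two (hb0 i j).1 (hb0 i j).2).add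
            ((hD' j).bdd_mul_two (ha0 i j).1 (ha0 i j).2)
        have hw : ∀ i, IsWeakPartial l (ball 0 r') (flux a g f i) (flux a D F i) := fun i => by
          have h3 := (IsWeakPartial.sum Finset.univ
            (fun j _ => ((hab i j).mono hsub).bdd_mul (hD j) (ha0 i j).1 (ha0 i j).2 (hb0 i j).1
              (hb0 i j).2 (hg' j) (hD' j)) (fun j _ => m1 i j) (fun j _ => m2 i j)).add
            ((hfdf i).mono hsub) (memLp_finsetSum _ fun j _ => m1 i j)
            (memLp_finsetSum _ fun j _ => m2 i j) (hf' i) (hdf' i)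
          have e : flux a D F i = fun x =>
              ∑ j, (b i j x * g j x + a i j x * D j x) + df i x := by
            ext x
            simp only [flux, F, Finset.sum_add_distrib]
            ring
          rw [e]
          exact h3
        have n1 := flux_memLp (fun i j => (ha0 i j).1) (fun i j => (ha0 i j).2) hg' hf'
        have n2 := flux_memLp (fun i j => (ha0 i j).1) (fun i j => (ha0 i j).2) hD'
          (fun i => (hF i).l2.1)
        have h0 := (hdiv.mono hsub) _ (hφ.partialD l)
        rw [integral_finsetSum _ fun i _ => integrable_mul_of_memLp_two (n1 i)
          (((hφ.partialD l).partialD i).memLp 2 _)] at h0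
        rw [integral_finsetSum _ fun i _ => integrable_mul_of_memLp_two (n2 i)
          ((hφ.partialD i).memLp 2 _), ← neg_eq_zero, ← h0, ← Finset.sum_neg_distrib]
        refine Finset.sum_congr rfl fun i _ => ?_
        rw [← hw i _ (hφ.partialD i), partialD_comm l i hφ.1]
      have h2 := hC₂ a (g l) D F (B * K) (ha.of_succ.mono_set hsub)
        ((h1 l).l2.mono (by gcongr; exact le_add_self))
        (fun i => (hDk i).l2.1) hDw hF hdiv' j
      refine h2.mono ?_
      rw [← mul_assoc]
      gcongr
      exact le_self_add

/-! ### Multi-indices and lists of directions -/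

/-- The iterated partial derivative along a list of directions, the head being applied last. -/
noncomputable def listD (l : List (Fin n)) (f : EucSp n → ℝ) : EucSp n → ℝ := l.foldr partialD f

theorem listD_cons (i : Fin n) (l : List (Fin n)) (f : EucSp n → ℝ) :
    listD (i :: l) f = partialD i (listD l f) := rfl

/-- The list in which the direction `i` occurs `β i` times, in increasing order. -/
def idxList (β : Fin n → ℕ) : List (Fin n) :=
  (List.finRange n).flatMap fun i => List.replicate (β i) i

theorem multiD_eq_listD (β : Fin n → ℕ) (f : EucSp n → ℝ) : multiD β f = listD (idxList β) f := by
  unfold multiD listD idxList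
  induction List.finRange n with
  | nil => rfl
  | cons i l ih =>
    rw [List.foldr_cons, List.flatMap_cons, List.foldr_append, ← ih]
    induction β i with
    | zero => rfl
    | succ k ihk => rw [Function.iterate_succ_apply', ihk, List.replicate_succ, List.foldr_cons]

theorem count_idxList (β : Fin n → ℕ) (i : Fin n) : (idxList β).count i = β i := by
  unfold idxList
  rw [List.count_flatMap]
  have h : ∀ l : List (Fin n), l.Nodup →
      (l.map (List.count i ∘ fun j => List.replicate (β j) j)).sum = if i ∈ l then β i else 0 := by
    intro l hl
    induction l with
    | nil => simp
    | cons j l ih =>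
      rw [List.nodup_cons] at hl
      rw [List.map_cons, List.sum_cons, ih hl.2]
      by_cases hij : j = i
      · subst hij; simp [hl.1]
      · have hij' : i ≠ j := fun h => hij h.symm
        simp [List.count_replicate, hij, hij']
  rw [h _ (List.nodup_finRange n)]
  simp

theorem length_idxList (β : Fin n → ℕ) : (idxList β).length = ∑ i, β i := by
  simp only [idxList, List.length_flatMap, List.length_replicate]
  rw [← List.ofFn_eq_map, List.sum_ofFn]

theorem perm_idxList_count (l : List (Fin n)) : l.Perm (idxList fun i => l.count i) :=
  List.perm_iff_count.2 fun i => (count_idxList (fun i => l.count i) i).symm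

theorem sum_count (l : List (Fin n)) : ∑ i, l.count i = l.length := by
  rw [← length_idxList, (perm_idxList_count l).length_eq]

theorem contDiffOn_partialD {Ω : Set (EucSp n)} (hΩ : IsOpen Ω) {f : EucSp n → ℝ} {m : ℕ}
    (hf : ContDiffOn ℝ (m + 1 : ℕ) f Ω) (i : Fin n) : ContDiffOn ℝ m (partialD i f) Ω :=
  (hf.fderiv_of_isOpen hΩ (m := m) (by norm_cast)).clm_apply contDiffOn_const

theorem contDiffOn_listD {Ω : Set (EucSp n)} (hΩ : IsOpen Ω) {f : EucSp n → ℝ} (l : List (Fin n))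
    {m : ℕ} (hf : ContDiffOn ℝ (m + l.length : ℕ) f Ω) : ContDiffOn ℝ m (listD l f) Ω := by
  induction l generalizing m with
  | nil => exact hf
  | cons i l ih =>
    refine contDiffOn_partialD hΩ (ih ?_) i
    rwa [List.length_cons, ← add_assoc, add_right_comm] at hf

theorem partialD_congr {Ω : Set (EucSp n)} (hΩ : IsOpen Ω) {f g : EucSp n → ℝ} (h : EqOn f g Ω)
    (i : Fin n) : EqOn (partialD i f) (partialD i g) Ω := fun x hx => by
  have hev : f =ᶠ[𝓝 x] g := (hΩ.eventually_mem hx).mono fun y hy => h hy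
  unfold partialD
  rw [hev.fderiv_eq]

/-- Iterated partial derivatives of a `C^m` function do not depend on the order. -/
theorem listD_perm {Ω : Set (EucSp n)} (hΩ : IsOpen Ω) {f : EucSp n → ℝ} {l l' : List (Fin n)}
    (h : l.Perm l') (hf : ContDiffOn ℝ l.length f Ω) : EqOn (listD l f) (listD l' f) Ω := by
  induction h with
  | nil => exact eqOn_refl _ _
  | cons i h ih => exact partialD_congr hΩ (ih (hf.of_le (by simp))) i
  | swap i j l =>
    refine partialD_comm_of_contDiffOn hΩ ?_ _ _
    exact contDiffOn_listD hΩ l (m := 2) (by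
      rwa [List.length_cons, List.length_cons, add_assoc, add_comm] at hf)
  | trans h₁ h₂ ih₁ ih₂ => exact (ih₁ hf).trans (ih₂ (by rwa [← h₁.length_eq]))

theorem IsTestFn.listD {Ω : Set (EucSp n)} {φ : EucSp n → ℝ} (h : IsTestFn Ω φ)
    (l : List (Fin n)) : IsTestFn Ω (listD l φ) := by
  induction l with
  | nil => exact h
  | cons i l ih => exact ih.partialD i

theorem listD_append (l l' : List (Fin n)) (f : EucSp n → ℝ) :
    listD (l ++ l') f = listD l (listD l' f) := List.foldr_append

theorem multiD_partialD {φ : EucSp n → ℝ} (hφ : ContDiff ℝ ∞ φ) (β : Fin n → ℕ) (i : Fin n) :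
    multiD β (partialD i φ) = multiD (β + Pi.single i 1) φ := by
  rw [multiD_eq_listD, multiD_eq_listD]
  have : listD (idxList β) (partialD i φ) = listD (idxList β ++ [i]) φ := by
    rw [listD_append]; rfl
  rw [this]
  ext x
  refine listD_perm isOpen_univ ?_ (hφ.of_le (mod_cast le_top)).contDiffOn (mem_univ x)
  refine List.perm_iff_count.2 fun j => ?_
  rw [List.count_append, count_idxList, count_idxList, Pi.add_apply]
  by_cases hij : j = i
  · subst hij; simp
  · have : i ≠ j := fun h => hij h.symm
    simp [this, hij]

theorem multiD_zero (φ : EucSp n → ℝ) : multiD 0 φ = φ := by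
  rw [multiD_eq_listD]
  have : idxList (0 : Fin n → ℕ) = [] := List.length_eq_zero_iff.1 (by simp [length_idxList])
  rw [this]; rfl

theorem sum_add_single (β : Fin n → ℕ) (i : Fin n) :
    ∑ j, (β + Pi.single i 1 : Fin n → ℕ) j = ∑ j, β j + 1 := by
  simp [Finset.sum_add_distrib]

/-! ### Comparison with `H^k` spaces defined by multi-indices -/

theorem locallyIntegrableOn_of_memLp {Ω : Set (EucSp n)} {u : EucSp n → ℝ}
    (hu : MemLp u 2 (volume.restrict Ω)) : LocallyIntegrableOn u Ω :=
  locallyIntegrableOn_of_locallyIntegrable_restrict (hu.locallyIntegrable (by norm_num))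

theorem isWeakPartial_of_hasWeakD {Ω : Set (EucSp n)} {β : Fin n → ℕ} {i : Fin n}
    {u v w : EucSp n → ℝ} (hv : HasWeakD Ω β u v) (hw : HasWeakD Ω (β + Pi.single i 1) u w) :
    IsWeakPartial i Ω v w := by
  intro φ hφ
  have h1 := hv.2.2 _ (hφ.partialD i)
  have h2 := hw.2.2 φ hφ
  rw [multiD_partialD hφ.1, h2, sum_add_single, pow_succ] at h1
  have h3 : ((-1 : ℝ) ^ ∑ j, β j) ≠ 0 := by positivity
  rw [mul_assoc] at h1
  have := mul_left_cancel₀ h3 h1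
  linarith

theorem hasWeakD_zero {Ω : Set (EucSp n)} {u : EucSp n → ℝ} (hu : MemLp u 2 (volume.restrict Ω)) :
    HasWeakD Ω 0 u u :=
  ⟨locallyIntegrableOn_of_memLp hu, locallyIntegrableOn_of_memLp hu, fun φ _ => by
    simp [multiD_zero]⟩

theorem HkBound.congr {k : ℕ} {Ω : Set (EucSp n)} {u v : EucSp n → ℝ} {K : ℝ≥0}
    (h : HkBound k Ω u K) (huv : u =ᵐ[volume.restrict Ω] v) : HkBound k Ω v K := by
  have h0 : HkBound 0 Ω v K := ⟨(memLp_congr_ae huv).1 h.l2.1, (eLpNorm_congr_ae huv) ▸ h.l2.2⟩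
  cases k with
  | zero => exact h0
  | succ k => exact ⟨h0, fun i => (h.2 i).imp fun _ hw => ⟨hw.1.congr huv .rfl, hw.2⟩⟩

theorem MemHk.weakD_memLp {k : ℕ} {Ω : Set (EucSp n)} (hΩ : IsOpen Ω) {u : EucSp n → ℝ}
    (hu : MemHk k Ω u) {β : Fin n → ℕ} (hβ : ∑ i, β i ≤ k) :
    HasWeakD Ω β u (weakD Ω β u) ∧ MemLp (weakD Ω β u) 2 (volume.restrict Ω) := by
  obtain ⟨v, hv, hv2⟩ := hu.2 β hβ
  exact ⟨hv.weakD, (memLp_congr_ae (hv.ae_eq hΩ hv.weakD)).1 hv2⟩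

/-- A function in `H^k(Ω)` all of whose weak derivatives have `L²` norm at most `K`. -/
theorem MemHk.hkBound {k : ℕ} {Ω : Set (EucSp n)} (hΩ : IsOpen Ω) {u : EucSp n → ℝ} {K : ℝ≥0}
    (hu : MemHk k Ω u)
    (hK : ∀ β : Fin n → ℕ, ∑ i, β i ≤ k → eLpNorm (weakD Ω β u) 2 (volume.restrict Ω) ≤ K) :
    HkBound k Ω u K := by
  have key : ∀ (m : ℕ) (β : Fin n → ℕ), ∑ i, β i + m ≤ k → HkBound m Ω (weakD Ω β u) K := by
    intro m
    induction m with
    | zero => exact fun β hβ => ⟨(hu.weakD_memLp hΩ hβ).2, hK β hβ⟩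
    | succ m ih =>
      intro β hβ
      have hβ' : ∑ i, β i ≤ k := by omega
      refine ⟨⟨(hu.weakD_memLp hΩ hβ').2, hK β hβ'⟩, fun i => ⟨_, ?_, ih (β + Pi.single i 1) ?_⟩⟩
      · refine isWeakPartial_of_hasWeakD (hu.weakD_memLp hΩ hβ').1 (hu.weakD_memLp hΩ ?_).1
        rw [sum_add_single]; omega
      · rw [sum_add_single]; omega
  refine (key k 0 (by simp)).congr ?_
  exact ((hu.weakD_memLp hΩ (by simp)).1).ae_eq hΩ (hasWeakD_zero hu.1)

/-- Weak derivatives along a list of directions: the head of the list acts last on the test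
function, hence first on `u`. -/
theorem HkBound.exists_listD {k : ℕ} {Ω : Set (EucSp n)} {u : EucSp n → ℝ} {K : ℝ≥0}
    (h : HkBound k Ω u K) (l : List (Fin n)) (hl : l.length ≤ k) :
    ∃ v, HkBound 0 Ω v K ∧ ∀ φ, IsTestFn Ω φ →
      ∫ x in Ω, u x * listD l φ x = (-1) ^ l.length * ∫ x in Ω, v x * φ x := by
  induction l generalizing k u with
  | nil => exact ⟨u, h.l2, fun φ _ => by simp [_root_.listD]⟩
  | cons i l ih =>
    cases k with
    | zero => simp at hl
    | succ k =>
      obtain ⟨w, huw, hw⟩ := h.2 i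
      obtain ⟨v, hv, hvφ⟩ := ih hw (by simpa using hl)
      refine ⟨v, hv, fun φ hφ => ?_⟩
      rw [listD_cons, huw _ (hφ.listD l), hvφ φ hφ, List.length_cons, pow_succ]
      ring

theorem HkBound.exists_hasWeakD {k : ℕ} {Ω : Set (EucSp n)} {u : EucSp n → ℝ} {K : ℝ≥0}
    (h : HkBound k Ω u K) {β : Fin n → ℕ} (hβ : ∑ i, β i ≤ k) :
    ∃ v, HasWeakD Ω β u v ∧ HkBound 0 Ω v K := by
  obtain ⟨v, hv, hvφ⟩ := h.exists_listD (idxList β) (by rwa [length_idxList])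
  refine ⟨v, ⟨locallyIntegrableOn_of_memLp h.l2.1, locallyIntegrableOn_of_memLp hv.1,
    fun φ hφ => ?_⟩, hv⟩
  rw [multiD_eq_listD, hvφ φ hφ, length_idxList]

theorem HkBound.memHk {k : ℕ} {Ω : Set (EucSp n)} {u : EucSp n → ℝ} {K : ℝ≥0}
    (h : HkBound k Ω u K) : MemHk k Ω u :=
  ⟨h.l2.1, fun _ hβ => (h.exists_hasWeakD hβ).imp fun _ hv => ⟨hv.1, hv.2.1⟩⟩

theorem HkBound.normHk_le {k : ℕ} {Ω : Set (EucSp n)} (hΩ : IsOpen Ω) {u : EucSp n → ℝ} {K : ℝ≥0}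
    (h : HkBound k Ω u K) :
    normHk k Ω u ≤
      ↑((∑ j ∈ Finset.range (k + 1), ((multiIdx n j).card : ℝ≥0)) ^ (1 / 2 : ℝ) * K) := by
  have h1 : sqNormHk k Ω u ≤
      ((∑ j ∈ Finset.range (k + 1), ((multiIdx n j).card : ℝ≥0) : ℝ≥0) : ℝ≥0∞) *
        (K : ℝ≥0∞) ^ 2 := by
    unfold sqNormHk
    rw [ENNReal.ofNNReal_finsetSum, Finset.sum_mul]
    refine Finset.sum_le_sum fun j hj => ?_
    calc _ ≤ ∑ _β ∈ multiIdx n j, (K : ℝ≥0∞) ^ 2 := by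
          refine Finset.sum_le_sum fun β hβ => ?_
          rw [mem_multiIdx] at hβ
          obtain ⟨v, hv, hv0⟩ := h.exists_hasWeakD (β := β) (by
            rw [hβ]; exact Nat.lt_succ_iff.1 (Finset.mem_range.1 hj))
          rw [eLpNorm_congr_ae (hv.weakD.ae_eq hΩ hv)]
          gcongr
          exact hv0.2
      _ = _ := by simp
  unfold normHk
  refine (ENNReal.rpow_le_rpow h1 (by norm_num)).trans (le_of_eq ?_)
  rw [ENNReal.mul_rpow_of_nonneg _ _ (by norm_num), ENNReal.coe_mul,
    ENNReal.coe_rpow_of_nonneg _ (by norm_num), ← ENNReal.rpow_natCast, ← ENNReal.rpow_mul]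
  simp

theorem MemHk.eLpNorm_weakD_le {k : ℕ} {Ω : Set (EucSp n)} {F : EucSp n → Fin n → ℝ} (i : Fin n)
    {β : Fin n → ℕ} (hβ : ∑ j, β j ≤ k) :
    eLpNorm (weakD Ω β fun x => F x i) 2 (volume.restrict Ω) ≤ normHkField k Ω F := by
  have h1 : eLpNorm (weakD Ω β fun x => F x i) 2 (volume.restrict Ω) ^ 2 ≤
      ∑ i, sqNormHk k Ω fun x => F x i := by
    refine le_trans ?_ (Finset.single_le_sum (f := fun i => sqNormHk k Ω fun x => F x i)
      (fun _ _ => zero_le) (Finset.mem_univ i))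
    unfold sqNormHk
    refine le_trans ?_ (Finset.single_le_sum (f := fun j => ∑ β ∈ multiIdx n j,
      eLpNorm (weakD Ω β fun x => F x i) 2 (volume.restrict Ω) ^ 2) (fun _ _ => zero_le)
      (Finset.mem_range.2 (Nat.lt_succ_iff.2 hβ)))
    exact Finset.single_le_sum
      (f := fun β => eLpNorm (weakD Ω β fun x => F x i) 2 (volume.restrict Ω) ^ 2)
      (fun _ _ => zero_le) (mem_multiIdx.2 rfl)
  unfold normHkField
  refine le_trans (le_of_eq ?_) (ENNReal.rpow_le_rpow h1 (by norm_num))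
  rw [← ENNReal.rpow_natCast, ← ENNReal.rpow_mul]
  simp

theorem normHkField_ne_top {k : ℕ} {Ω : Set (EucSp n)} (hΩ : IsOpen Ω) {F : EucSp n → Fin n → ℝ}
    (hF : ∀ i, MemHk k Ω fun x => F x i) : normHkField k Ω F ≠ ⊤ := by
  unfold normHkField sqNormHk
  refine ENNReal.rpow_ne_top_of_nonneg (by norm_num) ?_
  refine ENNReal.sum_ne_top.2 fun i _ => ENNReal.sum_ne_top.2 fun j hj =>
    ENNReal.sum_ne_top.2 fun β hβ => ENNReal.pow_ne_top ?_
  rw [mem_multiIdx] at hβ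
  exact ((hF i).weakD_memLp hΩ (by
    rw [hβ]; exact Nat.lt_succ_iff.1 (Finset.mem_range.1 hj))).2.2.ne

/-! ### Lipschitz functions and `C^{m,1}` coefficients -/

/-- The classical partial derivative of a Lipschitz function, which exists almost everywhere by
Rademacher's theorem, is its weak partial derivative. -/
theorem LipschitzOnWith.isWeakPartial {Ω : Set (EucSp n)} (hΩ : IsOpen Ω) {f : EucSp n → ℝ}
    {M : ℝ≥0} (hf : LipschitzOnWith M f Ω) (i : Fin n) : IsWeakPartial i Ω f (partialD i f) := by
  -- integration by parts is available for a global Lipschitz extension of `f`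
  obtain ⟨g, hg, hfg⟩ := hf.extend_real
  intro φ hφ
  obtain ⟨D, hD⟩ := hφ.1.lipschitzWith_of_hasCompactSupport hφ.2.1 (by simp)
  have h1 := hg.integral_lineDeriv_mul_eq (μ := volume) hD hφ.2.1 (coordVec i)
  have h2 : ∫ x in Ω, f x * partialD i φ x = ∫ x, g x * partialD i φ x := by
    refine Eq.trans (setIntegral_congr_fun (g := fun x => g x * partialD i φ x) hΩ.measurableSet
      fun x hx => by simp only [hfg hx]) ?_
    exact setIntegral_eq_integral_of_forall_compl_eq_zero fun x hx => by
      rw [(hφ.partialD i).eq_zero hx, mul_zero]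
  have h3 : ∫ x in Ω, partialD i f x * φ x = ∫ x, lineDeriv ℝ g x (coordVec i) * φ x := by
    refine Eq.trans (setIntegral_congr_ae (g := fun x => lineDeriv ℝ g x (coordVec i) * φ x)
      hΩ.measurableSet ?_) (setIntegral_eq_integral_of_forall_compl_eq_zero fun x hx => by
        rw [hφ.eq_zero hx, mul_zero])
    filter_upwards [hg.ae_differentiableAt] with x hx hxΩ
    rw [partialD_congr hΩ hfg i hxΩ, hx.lineDeriv_eq_fderiv]
    rfl
  have h4 : ∀ x, lineDeriv ℝ φ x (-coordVec i) = -partialD i φ x := fun x => by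
    rw [(hφ.differentiable x).lineDeriv_eq_fderiv]
    simp [partialD]
  rw [h2, h3, h1, ← integral_neg]
  simp_rw [h4]
  congr 1
  ext x
  ring

theorem LipschitzOnWith.abs_partialD_le {Ω : Set (EucSp n)} (hΩ : IsOpen Ω) {f : EucSp n → ℝ}
    {M : ℝ≥0} (hf : LipschitzOnWith M f Ω) (i : Fin n) {x : EucSp n} (hx : x ∈ Ω) :
    |partialD i f x| ≤ M := by
  have h := (fderiv ℝ f x).le_opNorm (coordVec i)
  rw [norm_coordVec, mul_one] at h
  exact h.trans (norm_fderiv_le_of_lipschitzOn ℝ (hΩ.mem_nhds hx) hf)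

theorem norm_le_of_abs_coordVec_le {T : EucSp n →L[ℝ] ℝ} {M : ℝ} (hM : 0 ≤ M)
    (h : ∀ i, |T (coordVec i)| ≤ M) : ‖T‖ ≤ n * M := by
  refine T.opNorm_le_bound (by positivity) fun v => ?_
  have hv : v = ∑ i, v i • coordVec i := by
    simpa using ((EuclideanSpace.basisFun (Fin n) ℝ).sum_repr v).symm
  calc ‖T v‖ = ‖∑ i, v i * T (coordVec i)‖ := by
        conv_lhs => rw [hv]
        simp
    _ ≤ ∑ i, ‖v i * T (coordVec i)‖ := norm_sum_le _ _
    _ ≤ ∑ _i : Fin n, M * ‖v‖ := Finset.sum_le_sum fun i _ => by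
        rw [norm_mul, mul_comm]
        exact mul_le_mul (h i) (PiLp.norm_apply_le v i) (norm_nonneg _) hM
    _ = n * M * ‖v‖ := by simp; ring

theorem lipschitzOnWith_of_lipSeminorm_le {Ω : Set (EucSp n)} {f : EucSp n → ℝ} {M : ℝ≥0}
    (h : lipSeminorm Ω f ≤ M) : LipschitzOnWith M f Ω := by
  intro x hx y hy
  by_cases hxy : x = y
  · simp [hxy]
  have h1 : ‖f x - f y‖ₑ / edist x y ≤ M :=
    le_trans (le_iSup₂_of_le x hx (le_iSup₂_of_le y hy
      (le_iSup (fun _ : x ≠ y => ‖f x - f y‖ₑ / edist x y) hxy))) h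
  rw [edist_eq_enorm_sub]
  exact (ENNReal.div_le_iff (edist_pos.2 hxy).ne' (edist_ne_top x y)).1 h1

/-- An almost everywhere bound of a function continuous in an open set holds everywhere. -/
theorem abs_le_of_ae_abs_le {Ω : Set (EucSp n)} (hΩ : IsOpen Ω) {f : EucSp n → ℝ} {M : ℝ}
    (hf : ContinuousOn f Ω) (h : ∀ᵐ x ∂volume.restrict Ω, |f x| ≤ M) {x : EucSp n} (hx : x ∈ Ω) :
    |f x| ≤ M := by
  by_contra hlt
  have ho : IsOpen (Ω ∩ (fun y => |f y|) ⁻¹' Ioi M) := hf.abs.isOpen_inter_preimage hΩ isOpen_Ioi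
  have hpos := ho.measure_pos volume ⟨x, hx, not_le.1 hlt⟩
  rw [ae_restrict_iff' hΩ.measurableSet] at h
  refine hpos.ne' (measure_mono_null (fun y hy => ?_) (ae_iff.1 h))
  exact fun h' => not_le.2 hy.2 (h' hy.1)

/-- A `C^{m,1}` function in a ball is Lipschitz and in `W^{m+1,∞}`. The Lipschitz bound for the
derivatives of order less than `m` comes from the mean value inequality. -/
theorem MemCkLip.regular {m : ℕ} {R : ℝ} {f : EucSp n → ℝ} {Lbar : ℝ≥0}
    (hf : MemCkLip m (ball 0 R) f) (hb : normCkLip m (ball 0 R) f ≤ Lbar) :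
    LipschitzOnWith ((n + 1) * Lbar) f (ball 0 R) ∧
      WkInfBound (m + 1) (ball 0 R) f ((n + 1) * Lbar) := by
  have hLM : Lbar ≤ (n + 1) * Lbar := le_mul_of_one_le_left zero_le le_add_self
  have hlist : ∀ l : List (Fin n), l.length ≤ m →
      EqOn (listD l f) (multiD (fun i => l.count i) f) (ball 0 R) := fun l hl => by
    rw [multiD_eq_listD]
    exact listD_perm isOpen_ball (perm_idxList_count l) (hf.1.of_le (by exact_mod_cast hl))
  have hcont : ∀ l : List (Fin n), l.length ≤ m → ContinuousOn (listD l f) (ball 0 R) :=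
    fun l hl => ((hf.2.1 _ (by rwa [sum_count])).continuousOn).congr (hlist l hl)
  have hsup : ∀ l : List (Fin n), l.length ≤ m → ∀ x ∈ ball (0 : EucSp n) R,
      |listD l f x| ≤ Lbar := by
    intro l hl x hx
    refine abs_le_of_ae_abs_le isOpen_ball (hcont l hl) ?_ hx
    have h1 : eLpNorm (multiD (fun i => l.count i) f) ⊤ (volume.restrict (ball 0 R)) ≤ Lbar := by
      refine le_trans ?_ (le_self_add.trans hb)
      refine le_trans ?_ (Finset.single_le_sum (f := fun j => ∑ β ∈ multiIdx n j,
        eLpNorm (multiD β f) ⊤ (volume.restrict (ball 0 R))) (fun _ _ => zero_le)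
        (Finset.mem_range.2 (Nat.lt_succ_iff.2 hl)))
      exact Finset.single_le_sum
        (f := fun β => eLpNorm (multiD β f) ⊤ (volume.restrict (ball 0 R)))
        (fun _ _ => zero_le) (mem_multiIdx.2 (sum_count l))
    rw [eLpNorm_exponent_top] at h1
    filter_upwards [ae_le_eLpNormEssSup (f := multiD (fun i => l.count i) f)
      (μ := volume.restrict (ball 0 R)), ae_restrict_mem measurableSet_ball] with y hy hyR
    rw [hlist l hl hyR]
    have := hy.trans h1
    rw [enorm_le_coe] at this
    exact_mod_cast this
  have hlip : ∀ l : List (Fin n), l.length ≤ m →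
      LipschitzOnWith ((n + 1) * Lbar) (listD l f) (ball 0 R) := by
    intro l hl
    rcases hl.eq_or_lt with heq | hlt
    · refine LipschitzOnWith.weaken ?_ hLM
      have h1 : lipSeminorm (ball 0 R) (multiD (fun i => l.count i) f) ≤ Lbar := by
        refine le_trans ?_ (le_add_self.trans hb)
        exact Finset.single_le_sum (f := fun β => lipSeminorm (ball 0 R) (multiD β f))
          (fun _ _ => zero_le) (mem_multiIdx.2 ((sum_count l).trans heq))
      intro x hx y hy
      rw [hlist l hl hx, hlist l hl hy]
      exact lipschitzOnWith_of_lipSeminorm_le h1 hx hy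
    · have hd : ContDiffOn ℝ 1 (listD l f) (ball 0 R) :=
        contDiffOn_listD isOpen_ball l (m := 1) (hf.1.of_le (by norm_cast; omega))
      refine Convex.lipschitzOnWith_of_nnnorm_fderiv_le (𝕜 := ℝ)
        (fun x hx => (hd.differentiableOn (by simp)).differentiableAt (isOpen_ball.mem_nhds hx))
        (fun x hx => ?_) (convex_ball 0 R)
      have h1 : ‖fderiv ℝ (listD l f) x‖ ≤ n * (Lbar : ℝ) :=
        norm_le_of_abs_coordVec_le Lbar.2 fun i => hsup (i :: l) hlt x hx
      rw [← NNReal.coe_le_coe, coe_nnnorm]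
      push_cast
      linarith [Lbar.2]
  refine ⟨hlip [] (Nat.zero_le _), ?_⟩
  have key : ∀ (k : ℕ) (l : List (Fin n)), l.length + k = m →
      WkInfBound (k + 1) (ball 0 R) (listD l f) ((n + 1) * Lbar) := by
    intro k
    induction k with
    | zero =>
      intro l hl
      have hl' : l.length ≤ m := by omega
      refine ⟨⟨(hcont l hl').aestronglyMeasurable measurableSet_ball, ?_⟩, fun i =>
        ⟨_, (hlip l hl').isWeakPartial isOpen_ball i,
          (measurable_fderiv_apply_const ℝ _ _).aestronglyMeasurable, ?_⟩⟩
      · filter_upwards [ae_restrict_mem measurableSet_ball] with x hx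
        exact (hsup l hl' x hx).trans (by exact_mod_cast hLM)
      · filter_upwards [ae_restrict_mem measurableSet_ball] with x hx
        exact (hlip l hl').abs_partialD_le isOpen_ball i hx
    | succ k ih =>
      intro l hl
      have hl' : l.length ≤ m := by omega
      refine ⟨⟨(hcont l hl').aestronglyMeasurable measurableSet_ball, ?_⟩, fun i =>
        ⟨_, (hlip l hl').isWeakPartial isOpen_ball i, ih (i :: l) ?_⟩⟩
      · filter_upwards [ae_restrict_mem measurableSet_ball] with x hx
        exact (hsup l hl' x hx).trans (by exact_mod_cast hLM)
      · rw [List.length_cons]; omega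
  exact key m [] (by simp)

/-! ### The regularity theorem -/

/-- The interior `H^k` estimate in terms of `HkBound`. -/
theorem exists_hkBound (n m : ℕ) {lam : ℝ} (hlam : 0 < lam) (Lbar : ℝ≥0) {r R : ℝ}
    (hr : 0 < r) (hrR : r < R) :
    ∃ C : ℝ≥0, ∀ (A : EucSp n → Matrix (Fin n) (Fin n) ℝ) (F : EucSp n → Fin n → ℝ)
      (u : EucSp n → ℝ) (Lam L : ℝ) (K : ℝ≥0), IsUnifElliptic lam Lam L (ball 0 R) A →
      (∀ i j, MemCkLip m (ball 0 R) (fun x => A x i j) ∧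
        normCkLip m (ball 0 R) (fun x => A x i j) ≤ Lbar) →
      (∀ i, HkBound (m + 1) (ball 0 R) (fun x => F x i) K) →
      IsWeakSol (ball 0 R) A F u → eLpNorm u 2 (volume.restrict (ball 0 R)) ≤ K →
      HkBound (m + 2) (ball 0 r) u (C * K) := by
  obtain ⟨C, hC⟩ := exists_higher_order n hlam ((n + 1) * Lbar) (m + 1) hr hrR
  refine ⟨C + 1, fun A F u Lam L K hell hA hF hu huK => ?_⟩
  set g : Fin n → EucSp n → ℝ := fun i => weakD (ball 0 R) (Pi.single i 1) u
  have hreg : IsRegularCoeff lam ((n + 1) * Lbar) (m + 1) (ball 0 R) fun i j x => A x i j := by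
    refine ⟨fun x hx ξ => ?_, fun i j => ((hA i j).1.regular (hA i j).2).1,
      fun i j => ((hA i j).1.regular (hA i j).2).2⟩
    simpa [dotProduct, Matrix.mulVec, sq] using (hell.1 x hx ξ).1
  have hwg : ∀ i, HasWeakD (ball 0 R) (Pi.single i 1) u (g i) ∧
      MemLp (g i) 2 (volume.restrict (ball 0 R)) := fun i =>
    hu.1.weakD_memLp isOpen_ball (by simp)
  have hug : ∀ i, IsWeakPartial i (ball 0 R) u (g i) := fun i =>
    isWeakPartial_of_hasWeakD (hasWeakD_zero hu.1.1) (by rw [zero_add]; exact (hwg i).1)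
  have hdiv : IsWeakDivFree (ball 0 R) (flux (fun i j x => A x i j) g fun i x => F x i) := by
    intro φ hφ
    have h := hu.2 φ hφ
    have hdφ := fun i => (hφ.partialD i).memLp 2 (volume.restrict (ball 0 R))
    have hAg : ∀ i, MemLp (fun x => (A x *ᵥ weakGrad (ball 0 R) u x) i) 2
        (volume.restrict (ball 0 R)) := fun i => by
      show MemLp (fun x => ∑ j, A x i j * g j x) 2 _
      exact memLp_finsetSum _ fun j _ =>
        (hwg j).2.bdd_mul_two (hreg.bound i j).bdd.1 (hreg.bound i j).bdd.2
    have i1 : Integrable (fun x => (A x *ᵥ weakGrad (ball 0 R) u x) ⬝ᵥ classGrad φ x)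
        (volume.restrict (ball 0 R)) :=
      integrable_finsetSum _ fun i _ => integrable_mul_of_memLp_two (hAg i) (hdφ i)
    have i2 : Integrable (fun x => F x ⬝ᵥ classGrad φ x) (volume.restrict (ball 0 R)) :=
      integrable_finsetSum _ fun i _ => integrable_mul_of_memLp_two (hF i).l2.1 (hdφ i)
    have e : ∀ x, ∑ i, flux (fun i j x => A x i j) g (fun i x => F x i) i x * partialD i φ x =
        (A x *ᵥ weakGrad (ball 0 R) u x) ⬝ᵥ classGrad φ x + F x ⬝ᵥ classGrad φ x := by
      intro x
      simp only [flux, add_mul, Finset.sum_add_distrib]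
      rfl
    simp_rw [e]
    rw [integral_add i1 i2, h, neg_add_cancel]
  have hfin := hC _ u g (fun i x => F x i) K hreg ⟨hu.1.1, huK⟩ (fun i => (hwg i).2) hug hF hdiv
  have hsub : ball (0 : EucSp n) r ⊆ ball 0 R := ball_subset_ball hrR.le
  have hu0 : HkBound 0 (ball 0 R) u K := ⟨hu.1.1, huK⟩
  refine ⟨(hu0.mono_set hsub).mono ?_, fun i => ⟨g i, (hug i).mono hsub, (hfin i).mono ?_⟩⟩
  · exact le_mul_of_one_le_left zero_le le_add_self
  · gcongr
    exact le_self_add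

end Sobolev

theorem mainTheorem8 (n k : ℕ) (hn : 2 ≤ n) (hk : 2 ≤ k)
    (lam Lam L Lbar : ℝ) (hlam : 0 < lam) (hLam : lam ≤ Lam) :
    ∃ C : ℝ → ℝ → ℝ,
      (∀ R r : ℝ, 0 < r → r < R → 0 < C R r) ∧
      (∀ M : ℝ, ∃ δ > 0, ∀ R r : ℝ, 0 < r → r < R → R - r < δ → M < C R r) ∧
      ∀ (R : ℝ), 0 < R →
        ∀ (A : EucSp n → Matrix (Fin n) (Fin n) ℝ) (F : EucSp n → Fin n → ℝ) (u : EucSp n → ℝ),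
          IsUnifElliptic lam Lam L (ball 0 R) A →
          (∀ i j, MemCkLip (k - 2) (ball 0 R) (fun x => A x i j) ∧
            normCkLip (k - 2) (ball 0 R) (fun x => A x i j) ≤ ENNReal.ofReal Lbar) →
          (∀ i, MemHk (k - 1) (ball 0 R) (fun x => F x i)) →
          IsWeakSol (ball 0 R) A F u →
          MemHkLoc k (ball 0 R) u ∧
            ∀ r : ℝ, 0 < r → r < R →
              MemHk k (ball 0 r) u ∧
              normHk k (ball 0 r) u ≤
                ENNReal.ofReal (C R r) *
                  (eLpNorm u 2 (volume.restrict (ball 0 R)) +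
                    normHkField (k - 1) (ball 0 R) F) := by
  obtain ⟨m, rfl⟩ : ∃ m, k = m + 2 := ⟨k - 2, by omega⟩
  have h1 : m + 2 - 1 = m + 1 := by omega
  simp only [h1, Nat.add_sub_cancel]
  have hC : ∀ R r : ℝ, ∃ C : NNReal, 0 < r → r < R →
      ∀ (A : EucSp n → Matrix (Fin n) (Fin n) ℝ) (F : EucSp n → Fin n → ℝ)
      (u : EucSp n → ℝ) (Lam L : ℝ) (K : NNReal), IsUnifElliptic lam Lam L (ball 0 R) A →
      (∀ i j, MemCkLip m (ball 0 R) (fun x => A x i j) ∧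
        normCkLip m (ball 0 R) (fun x => A x i j) ≤ Lbar.toNNReal) →
      (∀ i, HkBound (m + 1) (ball 0 R) (fun x => F x i) K) →
      IsWeakSol (ball 0 R) A F u → eLpNorm u 2 (volume.restrict (ball 0 R)) ≤ K →
      HkBound (m + 2) (ball 0 r) u (C * K) := by
    intro R r
    by_cases h : 0 < r ∧ r < R
    · obtain ⟨C, hC⟩ := exists_hkBound n m hlam Lbar.toNNReal h.1 h.2
      exact ⟨C, fun _ _ => hC⟩
    · exact ⟨0, fun h1 h2 => absurd ⟨h1, h2⟩ h⟩
  choose C hC using hC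
  set N : NNReal :=
    (∑ j ∈ Finset.range (m + 2 + 1), ((multiIdx n j).card : NNReal)) ^ (1 / 2 : ℝ)
  -- the summand `1 / (R - r)` makes the constant degenerate as `R - r → 0`
  refine ⟨fun R r => N * C R r + 1 / (R - r), fun R r hr hrR => ?_, fun M => ?_,
    fun R hR A F u hell hA hF hu => ?_⟩
  · have : 0 < 1 / (R - r) := one_div_pos.2 (sub_pos.2 hrR)
    positivity
  · refine ⟨1 / (|M| + 1), by positivity, fun R r hr hrR hδ => ?_⟩
    have h2 : |M| + 1 < 1 / (R - r) :=
      (lt_one_div (by positivity) (sub_pos.2 hrR)).2 hδ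
    have h3 : (0 : ℝ) ≤ N * C R r := by positivity
    linarith [le_abs_self M]
  set K₀ := eLpNorm u 2 (volume.restrict (ball 0 R)) + normHkField (m + 1) (ball 0 R) F
  have hK₀ : K₀ ≠ ⊤ := ENNReal.add_ne_top.2 ⟨hu.1.1.2.ne, normHkField_ne_top isOpen_ball hF⟩
  have hKc : (K₀.toNNReal : ENNReal) = K₀ := ENNReal.coe_toNNReal hK₀
  have key : ∀ r, 0 < r → r < R → HkBound (m + 2) (ball 0 r) u (C R r * K₀.toNNReal) :=
    fun r hr hrR => hC R r hr hrR A F u Lam L K₀.toNNReal hell hA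
      (fun i => (hF i).hkBound isOpen_ball fun β hβ => by
        rw [hKc]; exact (MemHk.eLpNorm_weakD_le i hβ).trans le_add_self)
      hu (by rw [hKc]; exact le_self_add)
  refine ⟨fun V hV hVc hVR => ?_, fun r hr hrR => ⟨(key r hr hrR).memHk, ?_⟩⟩
  · obtain ⟨ρ, hρR, hVρ⟩ := exists_lt_subset_ball isClosed_closure hVR
    have hr : max ρ (R / 2) < R := max_lt hρR (half_lt_self hR)
    refine ((key _ (lt_max_of_lt_right (half_pos hR)) hr).mono_set ?_).memHk
    exact (subset_closure.trans hVρ).trans (ball_subset_ball (le_max_left _ _))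
  · refine ((key r hr hrR).normHk_le isOpen_ball).trans ?_
    rw [← mul_assoc, ENNReal.coe_mul, hKc]
    gcongr
    rw [← ENNReal.ofReal_coe_nnreal]
    refine ENNReal.ofReal_le_ofReal ?_
    rw [NNReal.coe_mul]
    exact le_add_of_nonneg_right (one_div_pos.2 (sub_pos.2 hrR)).le
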